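/- Let $X=(X,d,\mu)$ be a compact metric space with a Borel measure $\mu$ such that $0<\mu(B)<\infty$ for every ball $B$, let $1<p<\infty$ and $q=\frac{p}{p-1}$. Let $\mathrm{Curv}(X)$ be the set of continuous rectifiable arc-length parametrized curves $\gamma:[0,\ell(\gamma)]\to X$ (constant curves included), with the metric $$d_{\mathrm{Curv}}(\gamma_1,\gamma_2)=\inf_{\sigma_1,\sigma_2}\ \sup_{t\in[0,1]} d\big(R_{\gamma_1}(\sigma_1(t)),R_{\gamma_2}(\sigma_2(t))\big),\qquad R_\gamma(t)=\gamma(\ell(\gamma)t),$$ where $\sigma_1,\sigma_2$ range over the continuous nondecreasing surjections of $[0,1]$. For Borel $\rho:X\to[0,\infty]$ put $\int_\gamma\rho\,ds=\int_0^{\ell(\gamma)}\rho(\gamma(t))\,dt$. For $\Gamma\subset\mathrm{Curv}(X)$ and $b:\Gamma\to\mathbb R$ let $\mathcal A(\Gamma,b)$ be the set of Borel $\rho:X\to[0,\infty]$ with $\int_\gamma\rho\,ds\ge b(\gamma)$ for all $\gamma\in\Gamma$, and let $$\mathrm{Mod}_p(\Gamma,b)=\inf_{\rho\in\mathcal A(\Gamma,b)}\int_X\rho^p\,d\mu,\qquad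 \mathrm{Mod}_p^c(\Gamma,b)=\inf_{\rho\in\mathcal A(\Gamma,b)\cap C(X)}\int_X\rho^p\,d\mu,$$ where $C(X)$ denotes the real-valued continuous functions and $C_+(X)$ the nonnegative ones. A property holds for $p$-a.e. $\gamma\in\Gamma$ if it holds for all $\gamma\in\Gamma\setminus E$ for some $E$ with $\mathrm{Mod}_p(E,1)=0$. A weak minimizer of $\mathrm{Mod}^c_p(\Gamma,b)$ is a Borel function $\rho:X\to[0,\infty]$ with $\int_\gamma\rho\,ds\ge b(\gamma)$ for $p$-a.e. $\gamma\in\Gamma$ and $\int_X\rho^p\,d\mu=\mathrm{Mod}_p^c(\Gamma,b)$. Let $\mathcal M_+(\Gamma)$ be the set of finite nonnegative Radon measures on $\Gamma$. For $\eta\in\mathcal M_+(\Gamma)$ let $A^{\mathsf T}\eta$ be the measure $(A^{\mathsf T}\eta)(E)=\int_\Gamma\int_\gamma \mathbf 1_E\,ds\,d\eta(\gamma)$ on $X$, and let $\mathcal B(\Gamma)$ be the set of $\eta\in\mathcal M_+(\Gamma)$ for which $A^{\mathsf T}\eta\ll\mu$ and $\big\|\frac{d(A^{\mathsf T}\eta)}{d\mu}\big\|_{L^q(X)}\le1$.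 Put $$\mathcal L(\rho,\eta)=\|\rho\|_{L^p(X)}-\int_\Gamma\Big(\int_\gamma\rho\,ds-b(\gamma)\Big)d\eta(\gamma)\in[-\infty,\infty).$$ **Proposition.** Let $\Gamma\subset\mathrm{Curv}(X)$ be compact and $b\in C(\Gamma)$ real-valued, with $\inf_\Gamma b>0$ and $0<\mathrm{Mod}_p^c(\Gamma,b)<\infty$, and let $$M=\frac{\mathrm{Mod}_p^c(\Gamma,b)^{1/p}}{\inf_\Gamma b}.$$ Then strong duality holds: $$\mathrm{Mod}_p^c(\Gamma,b)^{1/p}=\inf_{\rho\in\mathcal A(\Gamma,b)\cap C(X)}\|\rho\|_{L^p(X)}=\inf_{\rho\in C_+(X)}\ \sup_{\substack{\eta\in\mathcal M_+(\Gamma)\\ \eta(\Gamma)\le M}}\mathcal L(\rho,\eta)=\sup_{\substack{\eta\in\mathcal M_+(\Gamma)\\ \eta(\Gamma)\le M}}\ \inf_{\rho\in C_+(X)}\mathcal L(\rho,\eta)=\sup_{\substack{\eta\in\mathcal B(\Gamma)\\ \eta(\Gamma)\le M}}\int_\Gamma b\,d\eta .$$ Moreover there are a Borel function $\rho^*:X\to[0,\infty]$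 with $\int_X(\rho^*)^p\,d\mu<\infty$ and a measure $\eta^*\in\mathcal B(\Gamma)$ with $\eta^*(\Gamma)\le M$ such that: 1. $\rho^*$ is a weak minimizer of $\mathrm{Mod}_p^c(\Gamma,b)$ (in particular $\int_\gamma\rho^*\,ds\ge b(\gamma)$ for $p$-a.e. $\gamma\in\Gamma$), and every weak minimizer equals $\rho^*$ $\mu$-a.e.; 2. $\eta^*$ maximizes $\int_\Gamma b\,d\eta$ among all $\eta\in\mathcal B(\Gamma)$ with $\eta(\Gamma)\le M$; 3. $\mathrm{Mod}_p^c(\Gamma,b)^{1/p}=\|\rho^*\|_{L^p(X)}=\int_\Gamma b\,d\eta^*$; 4. $\int_\Gamma\big(\int_\gamma\rho^*\,ds-b(\gamma)\big)\,d\eta^*(\gamma)=0$, the integrand being $\eta^*$-integrable; 5. $\int_\gamma\rho^*\,ds=b(\gamma)$ for $\eta^*$-a.e. $\gamma\in\Gamma$; 6. $\dfrac{d(A^{\mathsf T}\eta^*)}{d\mu}=\Big(\dfrac{\rho^*}{\|\rho^*\|_{L^p(X)}}\Big)^{p-1}$ $\mu$-a.e.; 7. for every Borel $\rho:X\to[0,\infty]$,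 $$\int_\Gamma\int_\gamma\rho\,ds\,d\eta^*(\gamma)=\int_X\rho\Big(\frac{\rho^*}{\|\rho^*\|_{L^p(X)}}\Big)^{p-1}d\mu .$$ -/

import Mathlib

open MeasureTheory Set
open scoped ENNReal NNReal unitInterval

namespace CurveModulus

/-- A continuous rectifiable arc-length parametrized curve `γ : [0, ℓ(γ)] → X` (constant curves,
with `ℓ(γ) = 0`, are included). So that equality of curves is equality of the fields, `γ` is stored
as a function on `ℝ`, extended by its end values outside `[0, ℓ(γ)]`; this extension carries no
information. -/
@[ext]
structure Curv (X : Type*) [MetricSpace X] where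
  /-- the length `ℓ(γ)` -/
  length : ℝ
  length_nonneg : 0 ≤ length
  /-- the parametrization -/
  toFun : ℝ → X
  continuous_toFun : Continuous toFun
  const_left : ∀ t, t ≤ 0 → toFun t = toFun 0
  const_right : ∀ t, length ≤ t → toFun t = toFun length
  /-- arc-length parametrization: the restriction of `γ` to `[0, t]` has length `t` -/
  arcLength : ∀ t ∈ Icc 0 length, eVariationOn toFun (Icc 0 t) = ENNReal.ofReal t

/-- Continuous nondecreasing surjections of `[0, 1]`. -/
def Reparam : Type := {φ : C(I, I) // Monotone φ ∧ Function.Surjective φ}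

/-- The distance of the arcs represented by `R₁` and `R₂`: the infimum of the sup-distances
between their reparametrizations. -/
noncomputable def arcDist {X : Type*} [MetricSpace X] (R₁ R₂ : C(I, X)) : ℝ :=
  ⨅ φ : Reparam × Reparam, dist (R₁.comp φ.1.1) (R₂.comp φ.2.1)

section Arc

variable {X : Type*} [MetricSpace X]

theorem arcDist_bddBelow (R₁ R₂ : C(I, X)) : BddBelow
    (range fun φ : Reparam × Reparam => dist (R₁.comp φ.1.1) (R₂.comp φ.2.1)) :=
  ⟨0, by rintro _ ⟨φ, rfl⟩; exact dist_nonneg⟩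

/-- an increasing bijection of `[0, 1]` as a reparametrization -/
def Reparam.ofIso (h : I ≃o I) : Reparam :=
  ⟨⟨h, h.continuous⟩, h.monotone, h.surjective⟩

instance : Nonempty Reparam := ⟨Reparam.ofIso (OrderIso.refl I)⟩

theorem arcDist_nonneg (R₁ R₂ : C(I, X)) : 0 ≤ arcDist R₁ R₂ :=
  Real.iInf_nonneg fun _ => dist_nonneg

theorem arcDist_self (R : C(I, X)) : arcDist R R = 0 := by
  refine le_antisymm ?_ (arcDist_nonneg _ _)
  have := ciInf_le (arcDist_bddBelow R R)
    (Reparam.ofIso (OrderIso.refl I), Reparam.ofIso (OrderIso.refl I))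
  unfold arcDist
  simpa using this

theorem arcDist_comm (R₁ R₂ : C(I, X)) : arcDist R₁ R₂ = arcDist R₂ R₁ := by
  unfold arcDist
  rw [← (Equiv.prodComm Reparam Reparam).iInf_comp]
  exact iInf_congr fun φ => dist_comm _ _

/-- A reparametrization can be approximated by increasing bijections. -/
theorem Reparam.approx (φ : Reparam) (R : C(I, X)) {δ : ℝ} (hδ : 0 < δ) :
    ∃ h : I ≃o I, ∀ t, dist (R (φ.1 t)) (R (h t)) < δ := by
  obtain ⟨η, hη, hR⟩ := Metric.uniformContinuous_iff.1
    (CompactSpace.uniformContinuous_of_continuous R.continuous) δ hδ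
  obtain ⟨⟨φ, hφc⟩, hm, hs⟩ := φ
  simp only [ContinuousMap.coe_mk] at hm hs ⊢
  obtain ⟨ε, hε0, hε⟩ : ∃ ε : ℝ, 0 < ε ∧ ε < min η 1 := exists_between (lt_min hη one_pos)
  have hε1 : ε < 1 := hε.trans_le (min_le_right _ _)
  have hεη : ε < η := hε.trans_le (min_le_left _ _)
  let g : I → I := fun t => ⟨(1 - ε) * φ t + ε * t, by
    have h1 := (φ t).2.1; have h2 := (φ t).2.2; have h3 := t.2.1; have h4 := t.2.2
    constructor
    · have := mul_nonneg (sub_nonneg.2 hε1.le) h1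
      have := mul_nonneg hε0.le h3
      linarith
    · nlinarith⟩
  have hgc : Continuous g := by
    refine Continuous.subtype_mk ?_ _
    have := continuous_subtype_val.comp hφc
    fun_prop
  have hgm : StrictMono g := by
    intro s t hst
    have h1 : (φ s : ℝ) ≤ φ t := hm hst.le
    have h2 : (s : ℝ) < t := hst
    change (1 - ε) * (φ s : ℝ) + ε * s < (1 - ε) * (φ t : ℝ) + ε * t
    nlinarith
  have hφ0 : φ 0 = 0 := by
    obtain ⟨x, hx⟩ := hs 0
    exact le_antisymm (by simpa only [hx] using hm (show (0 : I) ≤ x from x.2.1)) (φ 0).2.1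
  have hφ1 : φ 1 = 1 := by
    obtain ⟨x, hx⟩ := hs 1
    exact le_antisymm (φ 1).2.2 (by simpa only [hx] using hm (show x ≤ (1 : I) from x.2.2))
  have hg0 : g 0 = 0 := by ext; simp [g, hφ0]
  have hg1 : g 1 = 1 := by ext; simp [g, hφ1]
  have hgs : Function.Surjective g := by
    intro y
    have := mem_range_of_exists_le_of_exists_ge hgc (c := y) ⟨0, by rw [hg0]; exact y.2.1⟩
      ⟨1, by rw [hg1]; exact y.2.2⟩
    exact this
  refine ⟨hgm.orderIsoOfSurjective g hgs, fun t => hR ?_⟩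
  change dist (φ t) (g t) < η
  rw [Subtype.dist_eq, Real.dist_eq]
  change |(φ t : ℝ) - ((1 - ε) * φ t + ε * t)| < η
  have h1 := (φ t).2.1; have h2 := (φ t).2.2; have h3 := t.2.1; have h4 := t.2.2
  rw [abs_lt]
  constructor <;> nlinarith

theorem exists_iso_of_arcDist_lt {R₁ R₂ : C(I, X)} {ε : ℝ} (h : arcDist R₁ R₂ < ε) :
    ∃ h : I ≃o I, ∀ t, dist (R₁ t) (R₂ (h t)) < ε := by
  obtain ⟨⟨φ, τ⟩, hφτ⟩ := exists_lt_of_ciInf_lt h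
  simp only at hφτ
  set d := dist (R₁.comp φ.1) (R₂.comp τ.1) with hd
  obtain ⟨f, hf⟩ := φ.approx R₁ (δ := (ε - d) / 2) (by linarith)
  obtain ⟨g, hg⟩ := τ.approx R₂ (δ := (ε - d) / 2) (by linarith)
  refine ⟨f.symm.trans g, fun t => ?_⟩
  have h1 := hf (f.symm t)
  have h2 := hg (f.symm t)
  have h3 : dist (R₁ (φ.1 (f.symm t))) (R₂ (τ.1 (f.symm t))) ≤ d :=
    ContinuousMap.dist_apply_le_dist (f := R₁.comp φ.1) (g := R₂.comp τ.1) (f.symm t)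
  rw [OrderIso.apply_symm_apply, dist_comm] at h1
  change dist (R₁ t) (R₂ (g (f.symm t))) < ε
  linarith [dist_triangle4 (R₁ t) (R₁ (φ.1 (f.symm t))) (R₂ (τ.1 (f.symm t))) (R₂ (g (f.symm t)))]

theorem arcDist_le_of_iso {R₁ R₂ : C(I, X)} {ε : ℝ} (h : I ≃o I)
    (hh : ∀ t, dist (R₁ t) (R₂ (h t)) ≤ ε) : arcDist R₁ R₂ ≤ ε := by
  have hε : 0 ≤ ε := dist_nonneg.trans (hh 0)
  refine (ciInf_le (arcDist_bddBelow R₁ R₂)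
    (Reparam.ofIso (OrderIso.refl I), Reparam.ofIso h)).trans ?_
  exact (ContinuousMap.dist_le hε).2 hh

theorem arcDist_triangle (R₁ R₂ R₃ : C(I, X)) :
    arcDist R₁ R₃ ≤ arcDist R₁ R₂ + arcDist R₂ R₃ := by
  refine le_of_forall_pos_le_add fun ε hε => ?_
  obtain ⟨f, hf⟩ := exists_iso_of_arcDist_lt (R₁ := R₁) (R₂ := R₂)
    (ε := arcDist R₁ R₂ + ε / 2) (by linarith)
  obtain ⟨g, hg⟩ := exists_iso_of_arcDist_lt (R₁ := R₂) (R₂ := R₃)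
    (ε := arcDist R₂ R₃ + ε / 2) (by linarith)
  refine arcDist_le_of_iso (f.trans g) fun t => ?_
  have h1 := hf t
  have h2 := hg (f t)
  change dist (R₁ t) (R₃ (g (f t))) ≤ _
  linarith [dist_triangle (R₁ t) (R₂ (f t)) (R₃ (g (f t)))]

end Arc

namespace Curv

variable {X : Type*} [MetricSpace X]

/-- The unit-interval reparametrization `R_γ(t) = γ(ℓ(γ) t)`. -/
def unitParam (γ : Curv X) : C(I, X) where
  toFun t := γ.toFun (γ.length * t)
  continuous_toFun := by have := γ.continuous_toFun; fun_prop

theorem eVariationOn_Icc (γ : Curv X) {s t : ℝ} (hs : 0 ≤ s) (hst : s ≤ t) (ht : t ≤ γ.length) :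
    eVariationOn γ.toFun (Icc s t) = ENNReal.ofReal (t - s) := by
  have h := eVariationOn.Icc_add_Icc γ.toFun (s := univ) hs hst (mem_univ _)
  simp only [univ_inter] at h
  rw [γ.arcLength s ⟨hs, hst.trans ht⟩, γ.arcLength t ⟨hs.trans hst, ht⟩] at h
  rw [ENNReal.ofReal_sub _ hs, ← h, ENNReal.add_sub_cancel_left ENNReal.ofReal_ne_top]

theorem eVariationOn_comp (γ : Curv X) (h : I ≃o I) {a b : I} (hab : a ≤ b) :
    eVariationOn (fun t => γ.unitParam (h t)) (Icc a b)
      = ENNReal.ofReal (γ.length * h b - γ.length * h a) := by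
  let ψ : I → ℝ := fun t => γ.length * h t
  have hψm : Monotone ψ := fun s t hst =>
    mul_le_mul_of_nonneg_left (h.monotone hst) γ.length_nonneg
  have hψc : Continuous ψ := by
    have := continuous_subtype_val.comp h.continuous
    exact continuous_const.mul this
  have him : ψ '' Icc a b = Icc (ψ a) (ψ b) := by
    refine Subset.antisymm ?_ (intermediate_value_Icc hab hψc.continuousOn)
    rintro _ ⟨x, hx, rfl⟩
    exact ⟨hψm hx.1, hψm hx.2⟩
  have := eVariationOn.comp_eq_of_monotoneOn γ.toFun (t := Icc a b) ψ (hψm.monotoneOn _)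
  change eVariationOn (γ.toFun ∘ ψ) (Icc a b) = _
  rw [this, him]
  refine γ.eVariationOn_Icc (mul_nonneg γ.length_nonneg (h a).2.1) (hψm hab) ?_
  exact mul_le_of_le_one_right γ.length_nonneg (h b).2.2

theorem eVariationOn_unitParam (γ : Curv X) {a b : I} (hab : a ≤ b) :
    eVariationOn γ.unitParam (Icc a b) = ENNReal.ofReal (γ.length * b - γ.length * a) :=
  γ.eVariationOn_comp (OrderIso.refl I) hab

/-- Along a sequence of curves that become uniformly close to `γ` after reparametrization, the
length of a piece is lower semicontinuous. -/
theorem eventually_lt_length {γ : Curv X} {γs : ℕ → Curv X} {h : ℕ → (I ≃o I)}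
    (hh : ∀ t, Filter.Tendsto (fun n => (γs n).unitParam (h n t)) Filter.atTop
      (nhds (γ.unitParam t))) {a b : I} (hab : a ≤ b) {c : ℝ}
    (hc : c < γ.length * b - γ.length * a) :
    ∀ᶠ n in Filter.atTop, c < (γs n).length * h n b - (γs n).length * h n a := by
  rcases lt_or_ge c 0 with hc0 | hc0
  · refine Filter.Eventually.of_forall fun n => hc0.trans_le ?_
    exact sub_nonneg.2 (mul_le_mul_of_nonneg_left ((h n).monotone hab) (γs n).length_nonneg)
  have hlt : ENNReal.ofReal c < eVariationOn γ.unitParam (Icc a b) := by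
    rw [eVariationOn_unitParam _ hab]
    exact (ENNReal.ofReal_lt_ofReal_iff (hc0.trans_lt hc)).2 hc
  have := eVariationOn.lowerSemicontinuous_aux (s := Icc a b) (p := Filter.atTop)
    (F := fun n t => (γs n).unitParam (h n t)) (fun t _ => hh t) hlt
  filter_upwards [this] with n hn
  rw [eVariationOn_comp _ _ hab] at hn
  exact (ENNReal.ofReal_lt_ofReal_iff_of_nonneg hc0).1 hn

theorem exists_iso_seq {γ : Curv X} {γs : ℕ → Curv X}
    (hd : ∀ n : ℕ, arcDist γ.unitParam (γs n).unitParam < 1 / ((n : ℝ) + 1)) :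
    ∃ h : ℕ → (I ≃o I), (∀ n t, dist (γ.unitParam t) ((γs n).unitParam (h n t))
        < 1 / ((n : ℝ) + 1)) ∧
      ∀ t, Filter.Tendsto (fun n => (γs n).unitParam (h n t)) Filter.atTop
        (nhds (γ.unitParam t)) := by
  choose h hh using fun n => exists_iso_of_arcDist_lt (hd n)
  refine ⟨h, hh, fun t => ?_⟩
  rw [tendsto_iff_dist_tendsto_zero]
  refine squeeze_zero (fun _ => dist_nonneg) (fun n => ?_) tendsto_one_div_add_atTop_nhds_zero_nat
  rw [dist_comm]
  exact (hh n t).le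

theorem length_le_of_arcDist_eq_zero {γ γ' : Curv X}
    (h0 : arcDist γ.unitParam γ'.unitParam = 0) : γ.length ≤ γ'.length := by
  obtain ⟨h, -, hh⟩ := exists_iso_seq (γ := γ) (γs := fun _ => γ')
    (fun n => by rw [h0]; positivity)
  refine le_of_forall_lt fun c hc => ?_
  obtain ⟨n, hn⟩ := (eventually_lt_length hh (a := 0) (b := 1) zero_le_one (c := c)
    (by simpa using hc)).exists
  have h1 : h n 1 = 1 := (h n).map_top
  have h2 : h n 0 = 0 := (h n).map_bot
  simpa [h1, h2] using hn

theorem eq_of_arcDist_eq_zero {γ γ' : Curv X}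
    (h0 : arcDist γ.unitParam γ'.unitParam = 0) : γ = γ' := by
  have hL : γ.length = γ'.length := le_antisymm (length_le_of_arcDist_eq_zero h0)
    (length_le_of_arcDist_eq_zero (by rw [arcDist_comm]; exact h0))
  obtain ⟨h, -, hh⟩ := exists_iso_seq (γ := γ) (γs := fun _ => γ')
    (fun n => by rw [h0]; positivity)
  have key : ∀ t : I, γ.unitParam t = γ'.unitParam t := by
    intro t
    refine tendsto_nhds_unique (hh t) ?_
    have ht : Filter.Tendsto (fun n => γ'.length * (h n t : ℝ)) Filter.atTop
        (nhds (γ'.length * (t : ℝ))) := by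
      refine tendsto_order.2 ⟨fun c hc => ?_, fun c hc => ?_⟩
      · have := eventually_lt_length hh (a := 0) (b := t) t.2.1 (c := c) (by simpa [hL] using hc)
        filter_upwards [this] with n hn
        have h2 : h n 0 = 0 := (h n).map_bot
        simpa [h2] using hn
      · have := eventually_lt_length hh (a := t) (b := 1) t.2.2 (c := γ'.length - c)
          (by rw [hL]; simp only [Icc.coe_one, mul_one]; linarith)
        filter_upwards [this] with n hn
        have h2 : h n 1 = 1 := (h n).map_top
        simp only [h2, Icc.coe_one, mul_one] at hn
        linarith
    exact (γ'.continuous_toFun.tendsto _).comp ht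
  have hmid : ∀ s ∈ Icc 0 γ.length, γ.toFun s = γ'.toFun s := by
    intro s hs
    rcases eq_or_lt_of_le γ.length_nonneg with h00 | hpos
    · have hs0 : s = 0 := le_antisymm (hs.2.trans h00.symm.le) hs.1
      have := key 0
      simpa [unitParam, hs0] using this
    · have := key ⟨s / γ.length, div_nonneg hs.1 hpos.le, (div_le_one hpos).2 hs.2⟩
      simp only [unitParam, ContinuousMap.coe_mk, ← hL] at this
      rwa [mul_div_cancel₀ _ hpos.ne'] at this
  refine Curv.ext hL (funext fun s => ?_)
  rcases le_total s 0 with hs | hs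
  · rw [γ.const_left s hs, γ'.const_left s hs]
    exact hmid 0 ⟨le_rfl, γ.length_nonneg⟩
  rcases le_total γ.length s with hs' | hs'
  · rw [γ.const_right s hs', γ'.const_right s (hL ▸ hs'), ← hL]
    exact hmid _ ⟨γ.length_nonneg, le_rfl⟩
  · exact hmid s ⟨hs, hs'⟩

/-- The space of curves with the distance `d(γ₁, γ₂) = arcDist R_γ₁ R_γ₂`. -/
noncomputable instance : MetricSpace (Curv X) where
  dist γ₁ γ₂ := arcDist γ₁.unitParam γ₂.unitParam
  dist_self _ := arcDist_self _
  dist_comm _ _ := arcDist_comm _ _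
  dist_triangle _ _ _ := arcDist_triangle _ _ _
  eq_of_dist_eq_zero h := eq_of_arcDist_eq_zero h

theorem dist_def (γ₁ γ₂ : Curv X) : dist γ₁ γ₂ = arcDist γ₁.unitParam γ₂.unitParam := rfl

/-- The Borel σ-algebra on the space of curves. -/
noncomputable instance : MeasurableSpace (Curv X) := borel _

instance : BorelSpace (Curv X) := ⟨rfl⟩

end Curv

section LineMeasure

variable {X : Type*} [MetricSpace X]

/-- The curve integral `∫_γ ρ ds = ∫_0^{ℓ(γ)} ρ(γ(t)) dt` of a function with values in `[0, ∞]`. -/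
noncomputable def lineIntegral (ρ : X → ℝ≥0∞) (γ : Curv X) : ℝ≥0∞ :=
  ∫⁻ t in Icc 0 γ.length, ρ (γ.toFun t)

variable [MeasurableSpace X]

/-- The arc-length measure `E ↦ ∫_γ 1_E ds` of a curve. -/
noncomputable def lineMeasure (γ : Curv X) : Measure X :=
  (volume.restrict (Icc 0 γ.length)).map γ.toFun

variable [BorelSpace X]

theorem lintegral_lineMeasure (γ : Curv X) {ρ : X → ℝ≥0∞} (hρ : Measurable ρ) :
    ∫⁻ x, ρ x ∂(lineMeasure γ) = lineIntegral ρ γ :=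
  lintegral_map hρ γ.continuous_toFun.measurable

theorem lineMeasure_apply (γ : Curv X) {E : Set X} (hE : MeasurableSet E) :
    lineMeasure γ E = volume (γ.toFun ⁻¹' E ∩ Icc 0 γ.length) := by
  rw [lineMeasure, Measure.map_apply γ.continuous_toFun.measurable hE,
    Measure.restrict_apply (γ.continuous_toFun.measurable hE)]

instance (γ : Curv X) : IsFiniteMeasure (lineMeasure γ) := by
  unfold lineMeasure; infer_instance

theorem exists_lt_lineMeasure {γ : Curv X} {γs : ℕ → Curv X}
    (hd : ∀ n : ℕ, arcDist γ.unitParam (γs n).unitParam < 1 / ((n : ℝ) + 1))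
    {U : Set X} (hU : IsOpen U) {c : ℝ≥0∞} (hc : c < lineMeasure γ U) :
    ∃ n, c < lineMeasure (γs n) U := by
  classical
  obtain ⟨h, hh1, hh⟩ := Curv.exists_iso_seq hd
  set L := γ.length with hL
  -- a compact set of parameters
  have hVo : IsOpen (γ.toFun ⁻¹' U ∩ Ioo 0 L) := (hU.preimage γ.continuous_toFun).inter isOpen_Ioo
  have hcV : c < volume (γ.toFun ⁻¹' U ∩ Ioo 0 L) := by
    rw [lineMeasure_apply γ hU.measurableSet] at hc
    refine hc.trans_le (le_of_eq (measure_congr ?_))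
    exact (Filter.EventuallyEq.refl _ _).inter Ioo_ae_eq_Icc.symm
  obtain ⟨K, hKV, hK, hcK⟩ := hVo.exists_lt_isCompact hcV
  obtain ⟨δ, hδ, hδV⟩ := hK.exists_cthickening_subset_open hVo hKV
  have hKne : K.Nonempty := by
    rw [nonempty_iff_ne_empty]; rintro rfl; simp at hcK
  obtain ⟨x0, hx0⟩ := hKne
  have hLpos : 0 < L := (hKV hx0).2.1.trans (hKV hx0).2.2
  obtain ⟨N, hN⟩ := exists_nat_gt (L / δ)
  have hN0 : (0 : ℝ) < N := (div_pos hLpos hδ).trans hN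
  have hLN : L / N < δ := by
    rw [div_lt_iff₀ hδ] at hN; rw [div_lt_iff₀ hN0]; linarith
  let a : ℕ → I := fun i => projIcc 0 1 zero_le_one ((i : ℝ) / N)
  have ha : ∀ i, i ≤ N → (a i : ℝ) = i / N := by
    intro i hi
    have : (i : ℝ) / N ∈ Icc (0 : ℝ) 1 :=
      ⟨by positivity, (div_le_one hN0).2 (by exact_mod_cast hi)⟩
    simp only [a, projIcc_of_mem zero_le_one this]
  have ham : Monotone a := by
    intro i j hij
    refine monotone_projIcc _ ?_
    have : (i : ℝ) ≤ j := by exact_mod_cast hij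
    gcongr
  let P : ℕ → Set ℝ := fun i => Icc (L * a i) (L * a (i + 1))
  have hlen : ∀ i < N, L * (a (i + 1) : ℝ) - L * a i = L / N := by
    intro i hi
    rw [ha i hi.le, ha (i + 1) hi]; push_cast; ring
  let G : Finset ℕ := (Finset.range N).filter fun i => (K ∩ P i).Nonempty
  have hGN : ∀ i ∈ G, i < N := fun i hi => Finset.mem_range.1 (Finset.mem_filter.1 hi).1
  have hPV : ∀ i ∈ G, P i ⊆ γ.toFun ⁻¹' U := by
    intro i hi x hx
    obtain ⟨y, hyK, hy⟩ := (Finset.mem_filter.1 hi).2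
    refine (hδV ?_).1
    refine Metric.mem_cthickening_of_dist_le x y δ K hyK ?_
    have := hlen i (hGN i hi)
    rw [Real.dist_eq, abs_le]
    constructor <;> linarith [hx.1, hx.2, hy.1, hy.2]
  have hKG : K ⊆ ⋃ i ∈ G, P i := by
    intro x hx
    have hx0 : 0 < x := (hKV hx).2.1
    have hxL : x < L := (hKV hx).2.2
    set i := ⌊x * N / L⌋₊ with hi
    have h1 : (i : ℝ) ≤ x * N / L := Nat.floor_le (by positivity)
    have h2 : x * N / L < i + 1 := Nat.lt_floor_add_one _
    have hiN : i < N := by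
      have : x * N / L < N := by
        rw [div_lt_iff₀ hLpos]; nlinarith
      exact_mod_cast h1.trans_lt this
    have hxP : x ∈ P i := by
      simp only [P, mem_Icc]
      rw [ha i hiN.le, ha (i + 1) hiN]
      push_cast
      rw [le_div_iff₀ hLpos] at h1
      rw [div_lt_iff₀ hLpos] at h2
      constructor
      · rw [mul_div_assoc', div_le_iff₀ hN0]; linarith
      · rw [mul_div_assoc', le_div_iff₀ hN0]; linarith
    exact mem_biUnion (Finset.mem_filter.2 ⟨Finset.mem_range.2 hiN, ⟨x, hx, hxP⟩⟩) hxP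
  have hcG : c < ENNReal.ofReal (G.card * (L / N)) := by
    refine hcK.trans_le ((measure_mono hKG).trans ((measure_biUnion_finset_le _ _).trans ?_))
    have : ∑ i ∈ G, volume (P i) = ∑ i ∈ G, ENNReal.ofReal (L / N) :=
      Finset.sum_congr rfl fun i hi => by rw [Real.volume_Icc, hlen i (hGN i hi)]
    rw [this, Finset.sum_const, nsmul_eq_mul, ENNReal.ofReal_mul (by positivity),
      ENNReal.ofReal_natCast]
  have hG0 : (0 : ℝ) < G.card := by
    rcases Nat.eq_zero_or_pos G.card with h0 | h0
    · rw [h0] at hcG; simp at hcG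
    · exact_mod_cast h0
  -- a slightly smaller length for each piece
  obtain ⟨r, hr0, hcr, hr⟩ : ∃ r : ℝ, 0 ≤ r ∧ c < ENNReal.ofReal (G.card * r) ∧ r < L / N := by
    have hctop : c ≠ ∞ := hcG.ne_top
    have h1 : c.toReal < G.card * (L / N) :=
      (ENNReal.lt_ofReal_iff_toReal_lt hctop).1 hcG
    obtain ⟨r, hr1, hr2⟩ := exists_between ((div_lt_iff₀' hG0).2 h1)
    refine ⟨r, (div_nonneg ENNReal.toReal_nonneg hG0.le).trans hr1.le, ?_, hr2⟩
    exact (ENNReal.lt_ofReal_iff_toReal_lt hctop).2 ((div_lt_iff₀' hG0).1 hr1)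
  have hev1 : ∀ᶠ n in Filter.atTop, ∀ i ∈ G,
      r < (γs n).length * h n (a (i + 1)) - (γs n).length * h n (a i) := by
    rw [Filter.eventually_all_finset]
    intro i hi
    refine Curv.eventually_lt_length hh (ham i.le_succ) ?_
    rw [← hL, hlen i (hGN i hi)]; exact hr
  have hev2 : ∀ᶠ n in Filter.atTop, ∀ i ∈ G, ∀ t ∈ Icc (a i) (a (i + 1)),
      (γs n).unitParam (h n t) ∈ U := by
    rw [Filter.eventually_all_finset]
    intro i hi
    have hcomp : IsCompact (γ.unitParam '' Icc (a i) (a (i + 1))) :=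
      isCompact_Icc.image γ.unitParam.continuous
    have hsub : γ.unitParam '' Icc (a i) (a (i + 1)) ⊆ U := by
      rintro _ ⟨t, ht, rfl⟩
      refine hPV i hi (a := L * t) ⟨?_, ?_⟩
      · exact mul_le_mul_of_nonneg_left ht.1 hLpos.le
      · exact mul_le_mul_of_nonneg_left ht.2 hLpos.le
    obtain ⟨ε, hε, hεU⟩ := hcomp.exists_cthickening_subset_open hU hsub
    have hlim := (tendsto_one_div_add_atTop_nhds_zero_nat (𝕜 := ℝ)).eventually (gt_mem_nhds hε)
    filter_upwards [hlim] with n hn t ht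
    refine hεU (Metric.mem_cthickening_of_dist_le _ (γ.unitParam t) ε _ ⟨t, ht, rfl⟩ ?_)
    rw [dist_comm]
    exact (hh1 n t).le.trans hn.le
  obtain ⟨n, hn1, hn2⟩ := (hev1.and hev2).exists
  refine ⟨n, hcr.trans_le ?_⟩
  set γ' := γs n
  let u : ℕ → ℝ := fun i => γ'.length * h n (a i)
  have hu : Monotone u := fun i j hij =>
    mul_le_mul_of_nonneg_left ((h n).monotone (ham hij)) γ'.length_nonneg
  have hdisj : Pairwise (Function.onFun Disjoint fun i => Ioc (u i) (u (i + 1))) :=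
    hu.pairwise_disjoint_on_Ioc_succ
  have hsub : (⋃ i ∈ G, Ioc (u i) (u (i + 1))) ⊆ γ'.toFun ⁻¹' U ∩ Icc 0 γ'.length := by
    refine iUnion₂_subset fun i hi x hx => ?_
    have hγ0 : 0 ≤ u i := mul_nonneg γ'.length_nonneg (h n (a i)).2.1
    have hγ1 : u (i + 1) ≤ γ'.length :=
      mul_le_of_le_one_right γ'.length_nonneg (h n (a (i + 1))).2.2
    refine ⟨?_, hγ0.trans hx.1.le, hx.2.trans hγ1⟩
    have hcont : ContinuousOn (fun t : I => γ'.length * (h n t : ℝ)) (Icc (a i) (a (i + 1))) :=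
      (continuous_const.mul (continuous_subtype_val.comp (h n).continuous)).continuousOn
    obtain ⟨t, ht, rfl⟩ := intermediate_value_Icc (ham i.le_succ) hcont ⟨hx.1.le, hx.2⟩
    exact hn2 i hi t ht
  rw [lineMeasure_apply _ hU.measurableSet]
  refine le_trans ?_ (measure_mono hsub)
  rw [measure_biUnion_finset (fun i _ j _ hij => hdisj hij) fun i _ => measurableSet_Ioc]
  calc ENNReal.ofReal (G.card * r) = ∑ i ∈ G, ENNReal.ofReal r := by
        rw [Finset.sum_const, nsmul_eq_mul, ENNReal.ofReal_mul (by positivity),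
          ENNReal.ofReal_natCast]
    _ ≤ ∑ i ∈ G, volume (Ioc (u i) (u (i + 1))) := by
        refine Finset.sum_le_sum fun i hi => ?_
        rw [Real.volume_Ioc]
        exact ENNReal.ofReal_le_ofReal (hn1 i hi).le

theorem isOpen_lt_lineMeasure {U : Set X} (hU : IsOpen U) (c : ℝ≥0∞) :
    IsOpen {γ : Curv X | c < lineMeasure γ U} := by
  rw [Metric.isOpen_iff]
  intro γ hγ
  by_contra! hcon
  have : ∀ n : ℕ, ∃ γ' : Curv X, dist γ γ' < 1 / ((n : ℝ) + 1) ∧ ¬ c < lineMeasure γ' U := by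
    intro n
    obtain ⟨γ', h1, h2⟩ := not_subset.1 (hcon (1 / ((n : ℝ) + 1)) (by positivity))
    exact ⟨γ', by rw [dist_comm]; exact h1, h2⟩
  choose γs h1 h2 using this
  obtain ⟨n, hn⟩ := exists_lt_lineMeasure (γ := γ) (γs := γs) h1 hU hγ
  exact h2 n hn

/-- Curve integrals depend measurably on the curve. -/
theorem measurable_lineMeasure : Measurable (lineMeasure : Curv X → Measure X) := by
  have hopen : ∀ U : Set X, IsOpen U → Measurable fun γ : Curv X => lineMeasure γ U :=
    fun U hU => measurable_of_Ioi fun c => (isOpen_lt_lineMeasure hU c).measurableSet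
  exact Measurable.measure_of_isPiSystem (BorelSpace.measurable_eq (α := X)) isPiSystem_isOpen
    (fun U hU => hopen U hU) (hopen univ isOpen_univ)

end LineMeasure

section Modulus

variable {X : Type*} [MetricSpace X]

/-- Finite nonnegative Radon measures on `Y`. -/
def radonMeasures (Y : Type*) [TopologicalSpace Y] [MeasurableSpace Y] : Set (Measure Y) :=
  {η | IsFiniteMeasure η ∧ η.Regular}

variable [MeasurableSpace X]

/-- `ρ` is a Borel function `X → [0, ∞]` with `∫_γ ρ ds ≥ b(γ)` for all `γ ∈ Γ`. -/
def IsAdmissible (Γ : Set (Curv X)) (b : Γ → ℝ) (ρ : X → ℝ≥0∞) : Prop :=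
  Measurable ρ ∧ ∀ γ : Γ, ENNReal.ofReal (b γ) ≤ lineIntegral ρ γ

/-- The `p`-modulus of `Γ` with respect to the bounding function `b`. -/
noncomputable def modulus (μ : Measure X) (p : ℝ) (Γ : Set (Curv X)) (b : Γ → ℝ) : ℝ≥0∞ :=
  ⨅ (ρ : X → ℝ≥0∞) (_ : IsAdmissible Γ b ρ), ∫⁻ x, ρ x ^ p ∂μ

/-- The continuous `p`-modulus: the infimum is over continuous admissible `ρ : X → [0, ∞)`. -/
noncomputable def contModulus (μ : Measure X) (p : ℝ) (Γ : Set (Curv X)) (b : Γ → ℝ) : ℝ≥0∞ :=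
  ⨅ (ρ : C(X, ℝ≥0)) (_ : IsAdmissible Γ b fun x => (ρ x : ℝ≥0∞)), ∫⁻ x, (ρ x : ℝ≥0∞) ^ p ∂μ

/-- `∫_γ ρ ds ≥ b(γ)` for `p`-almost every `γ ∈ Γ`, that is, outside a family of curves whose
`p`-modulus (with bounding function `1`) is zero. -/
def IsWeaklyAdmissible (μ : Measure X) (p : ℝ) (Γ : Set (Curv X)) (b : Γ → ℝ)
    (ρ : X → ℝ≥0∞) : Prop :=
  Measurable ρ ∧ ∃ E : Set (Curv X), modulus μ p E (fun _ => 1) = 0 ∧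
    ∀ γ : Γ, (γ : Curv X) ∉ E → ENNReal.ofReal (b γ) ≤ lineIntegral ρ γ

/-- Weak minimizers of the continuous modulus problem. -/
def IsWeakMinimizer (μ : Measure X) (p : ℝ) (Γ : Set (Curv X)) (b : Γ → ℝ)
    (ρ : X → ℝ≥0∞) : Prop :=
  IsWeaklyAdmissible μ p Γ b ρ ∧ ∫⁻ x, ρ x ^ p ∂μ = contModulus μ p Γ b

/-- The projected measure `Aᵀη` of a measure `η` on `Γ`: `E ↦ ∫_Γ ∫_γ 1_E ds dη(γ)`
(see `projectedMeasure_apply`). -/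
noncomputable def projectedMeasure {Γ : Set (Curv X)} (η : Measure Γ) : Measure X :=
  η.bind fun γ => lineMeasure (γ : Curv X)

theorem projectedMeasure_apply [BorelSpace X] {Γ : Set (Curv X)} (η : Measure Γ) {E : Set X}
    (hE : MeasurableSet E) :
    projectedMeasure η E = ∫⁻ γ : Γ, lineIntegral (E.indicator 1) (γ : Curv X) ∂η := by
  have hm : Measurable fun γ : Γ => lineMeasure (γ : Curv X) :=
    measurable_lineMeasure.comp measurable_subtype_coe
  rw [projectedMeasure, Measure.bind_apply hE hm.aemeasurable]
  refine lintegral_congr fun γ => ?_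
  rw [← lintegral_lineMeasure _ (measurable_one.indicator hE), lintegral_indicator_one hE]

/-- The finite Radon measures `η` on `Γ` whose projected measure has a density with respect to `μ`
of `L^q`-norm at most `1`. -/
def barycenterClass (μ : Measure X) (q : ℝ) (Γ : Set (Curv X)) : Set (Measure Γ) :=
  {η | η ∈ radonMeasures Γ ∧ ∃ g : X → ℝ≥0∞, Measurable g ∧ projectedMeasure η = μ.withDensity g ∧
    eLpNorm g (ENNReal.ofReal q) μ ≤ 1}

/-- The Lagrangian `‖ρ‖_p - ∫_Γ (∫_γ ρ ds - b(γ)) dη ∈ [-∞, ∞)`, for continuous `ρ ≥ 0`. Since `b`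
will be bounded and `η` finite, the integral over `Γ` is the difference of
`∫_Γ ∫_γ ρ ds dη ∈ [0, ∞]` and `∫_Γ b dη ∈ ℝ`. -/
noncomputable def lagrangian (μ : Measure X) (p : ℝ) {Γ : Set (Curv X)} (b : Γ → ℝ)
    (ρ : C(X, ℝ≥0)) (η : Measure Γ) : EReal :=
  (eLpNorm (fun x => (ρ x : ℝ≥0∞)) (ENNReal.ofReal p) μ : EReal) -
    ((∫⁻ γ : Γ, lineIntegral (fun x => (ρ x : ℝ≥0∞)) (γ : Curv X) ∂η : ℝ≥0∞) -
      ((∫ γ, b γ ∂η : ℝ) : EReal))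

end Modulus

end CurveModulus

open CurveModulus

open Filter Topology

namespace CurveModulus

/-! Write `V` for the `1/p`-th power of the continuous modulus and `β = inf b`, so that `M = V/β`.
Along converging curves, curve integrals of continuous nonnegative functions are only lower
semicontinuous, because length may drop in the limit. Hence `ρ ↦ (γ ↦ ∫_γ ρ ds)` does not map into
`C(Γ)`. Duality is therefore obtained from Hahn–Banach, applied on `C(Γ)` to the sublinear value
function `Q(f) = inf {‖ρ‖_p + M m : f ≤ ∫_γ ρ ds + m on Γ}`.

Dual side. If `ρ` misses the constraint by at most `m < β`, then `ρ / (1 - m/β)` is admissible; this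
gives `Q(b) ≥ V` (`le_add_penalty`). A linear functional below `Q` whose value at `b` is at least
`V` is positive, since `Q ≤ 0` on nonpositive functions, so it is a Radon measure `η`; the slack `m`
bounds its mass by `M` (`exists_multiplier`). Integrating continuous minorants of the lower
semicontinuous function `γ ↦ ∫_γ ρ ds` gives `∫∫_γ ρ ds dη ≤ ‖ρ‖_p` for continuous `ρ`, then for
Borel `ρ`. Thus `Aᵀη = g μ` with `‖g‖_q ≤ 1`. Weak duality gives `∫ b dη ≤ V`, so `η` is optimal.

Primal side. A minimizing sequence satisfies `V = ∫ b dη ≤ ∫ f_n g dμ ≤ ‖f_n‖_p → V`, so it is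
almost extremal in Hölder's inequality. The pointwise defect in Young's inequality then tends to
zero in `L¹`, and a subsequence converges a.e. to `V g^(q-1)`
(`exists_subseq_ae_tendsto_of_le_lintegral_mul`). With convergence of norms, the positive parts of
`f_n - V g^(q-1)` vanish in `L^p`, and Fuglede's lemma makes the limit `ρ*` weakly admissible.

The rest follows from `ρ* = V g^(q-1)` and `‖g‖_q = 1`. Exceptional families are `η`-null, so `∫_γ
ρ* ds ≥ b` holds `η`-a.e.; both sides integrate to `V`, hence agree a.e. Every weak minimizer is
itself extremal for `g`, which gives uniqueness. -/

theorem lineIntegral_mono {X : Type*} [MetricSpace X] {ρ₁ ρ₂ : X → ℝ≥0∞}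
    (h : ∀ x, ρ₁ x ≤ ρ₂ x) (γ : Curv X) : lineIntegral ρ₁ γ ≤ lineIntegral ρ₂ γ :=
  lintegral_mono fun _ => h _

/-! ### Lower semicontinuity and measurability of curve integrals -/

section Semicontinuity

variable {X : Type*} [MetricSpace X] [MeasurableSpace X] [BorelSpace X]

theorem lineMeasure_le_liminf {γ : Curv X} {γs : ℕ → Curv X} (h : Tendsto γs atTop (𝓝 γ))
    {U : Set X} (hU : IsOpen U) :
    lineMeasure γ U ≤ liminf (fun n => lineMeasure (γs n) U) atTop := by
  refine le_of_forall_lt fun c hc => ?_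
  obtain ⟨c', hc1, hc2⟩ := exists_between hc
  refine hc1.trans_le (le_liminf_of_le (by isBoundedDefault) ?_)
  filter_upwards [h.eventually ((isOpen_lt_lineMeasure hU c').mem_nhds hc2)] with n hn
  exact le_of_lt hn

/-- The superlevel sets of a continuous `ρ` are open, and arc-length measure is lower semicontinuous
on open sets; a layer-cake argument passes this to integrals. -/
theorem lowerSemicontinuous_lineIntegral (ρ : C(X, ℝ≥0)) :
    LowerSemicontinuous fun γ : Curv X => lineIntegral (fun x => (ρ x : ℝ≥0∞)) γ := by
  rw [lowerSemicontinuous_iff_isClosed_preimage]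
  intro c
  refine IsSeqClosed.isClosed fun γs γ hγs hγ => ?_
  simp only [mem_preimage, mem_Iic] at hγs ⊢
  have hm : Measurable fun x => (ρ x : ℝ≥0∞) := ρ.continuous.measurable.coe_nnreal_ennreal
  have key := lintegral_le_liminf_lintegral_of_forall_isOpen_measure_le_liminf_measure
    (μ := lineMeasure γ) (μs := fun n => lineMeasure (γs n)) (f := fun x => (ρ x : ℝ))
    (NNReal.continuous_coe.comp ρ.continuous) (fun x => (ρ x).2)
    (fun G hG => lineMeasure_le_liminf hγ hG)
  simp only [ENNReal.ofReal_coe_nnreal, lintegral_lineMeasure _ hm] at key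
  refine key.trans (liminf_le_of_frequently_le ?_ (by isBoundedDefault))
  exact Frequently.of_forall hγs

theorem measurable_lineIntegral {ρ : X → ℝ≥0∞} (hρ : Measurable ρ) :
    Measurable fun γ : Curv X => lineIntegral ρ γ := by
  simp_rw [← lintegral_lineMeasure _ hρ]
  exact (Measure.measurable_lintegral hρ).comp measurable_lineMeasure

theorem lintegral_projectedMeasure {Γ : Set (Curv X)} (η : Measure Γ) {ρ : X → ℝ≥0∞}
    (hρ : Measurable ρ) :
    ∫⁻ x, ρ x ∂projectedMeasure η = ∫⁻ γ : Γ, lineIntegral ρ (γ : Curv X) ∂η := by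
  have hm : Measurable fun γ : Γ => lineMeasure (γ : Curv X) :=
    measurable_lineMeasure.comp measurable_subtype_coe
  rw [projectedMeasure, Measure.lintegral_bind hm.aemeasurable hρ.aemeasurable]
  exact lintegral_congr fun γ => lintegral_lineMeasure _ hρ

theorem lineIntegral_const_mul (c : ℝ≥0∞) {ρ : X → ℝ≥0∞} (hρ : Measurable ρ) (γ : Curv X) :
    lineIntegral (fun x => c * ρ x) γ = c * lineIntegral ρ γ :=
  lintegral_const_mul c (hρ.comp γ.continuous_toFun.measurable)

theorem lineIntegral_add {ρ₁ : X → ℝ≥0∞} (h₁ : Measurable ρ₁) (ρ₂ : X → ℝ≥0∞)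
    (γ : Curv X) :
    lineIntegral (fun x => ρ₁ x + ρ₂ x) γ = lineIntegral ρ₁ γ + lineIntegral ρ₂ γ :=
  lintegral_add_left (h₁.comp γ.continuous_toFun.measurable) _

end Semicontinuity

/-- The integral of a lower semicontinuous function is determined by its continuous minorants. -/
theorem lintegral_le_of_forall_continuous_le {Y : Type*} [PseudoEMetricSpace Y]
    [MeasurableSpace Y] [BorelSpace Y] (η : Measure Y) {F : Y → ℝ≥0∞}
    (hF : LowerSemicontinuous F) {C : ℝ≥0∞}
    (h : ∀ f : C(Y, ℝ≥0), (∀ y, (f y : ℝ≥0∞) ≤ F y) → ∫⁻ y, f y ∂η ≤ C) :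
    ∫⁻ y, F y ∂η ≤ C := by
  -- Inf-convolution of the truncation `min F n`: it is `n`-Lipschitz and lies below `F`. The
  -- truncation keeps it finite, so that it becomes an `ℝ≥0`-valued continuous function.
  let f : ℕ → Y → ℝ≥0∞ := fun n y => ⨅ z, (min (F z) n + n * edist y z)
  have hfn : ∀ n y, f n y ≤ min (F y) n := fun n y => by
    refine (iInf_le _ y).trans ?_
    simp
  have hfc : ∀ n, Continuous (f n) := fun n => by
    refine continuous_of_le_add_edist n (ENNReal.natCast_ne_top n) fun x y => ?_
    simp only [f]
    rw [ENNReal.iInf_add]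
    refine le_iInf fun z => (iInf_le _ z).trans ?_
    rw [add_assoc, ← mul_add, add_comm (edist y z)]
    gcongr
    exact edist_triangle _ _ _
  have hmono : Monotone f := fun m n hmn y => by
    refine iInf_mono fun z => ?_
    gcongr
  have hsup : ∀ y, F y = ⨆ n, f n y := by
    intro y
    refine le_antisymm (le_of_forall_lt fun c hc => ?_)
      (iSup_le fun n => (hfn n y).trans (min_le_left _ _))
    obtain ⟨c', hcc', hc'⟩ := exists_between hc
    obtain ⟨ε, hε, hball⟩ := EMetric.mem_nhds_iff.1 (hF y c' hc')
    -- Inside the ball of radius `ε` the term `min (F z) n` is at least `c'`; outside it the penalty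
    -- `n * edist y z` is.
    obtain ⟨n, hn⟩ : ∃ n : ℕ, c' ≤ n ∧ c' ≤ n * ε := by
      have hc't : c' ≠ ∞ := hc'.ne_top
      obtain ⟨n₁, h₁⟩ := ENNReal.exists_nat_gt hc't
      obtain ⟨n₂, h₂⟩ := ENNReal.exists_nat_mul_gt hε.ne' hc't
      refine ⟨max n₁ n₂, h₁.le.trans (by exact_mod_cast le_max_left _ _), h₂.le.trans ?_⟩
      gcongr
      exact le_max_right _ _
    refine hcc'.trans_le (le_iSup_of_le n (le_iInf fun z => ?_))
    rcases lt_or_ge (edist y z) ε with hz | hz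
    · refine le_add_right (le_min (le_of_lt ?_) hn.1)
      exact hball (by simpa [edist_comm] using hz)
    · exact le_add_left (hn.2.trans (by gcongr))
  simp_rw [hsup]
  rw [lintegral_iSup (fun n => (hfc n).measurable) hmono]
  refine iSup_le fun n => ?_
  have hne : ∀ y, f n y ≠ ∞ := fun y =>
    ((hfn n y).trans_lt ((min_le_right _ _).trans_lt (ENNReal.natCast_lt_top n))).ne
  refine le_trans (le_of_eq ?_) (h ⟨fun y => (f n y).toNNReal, ?_⟩ fun y => ?_)
  · exact lintegral_congr fun y => (ENNReal.coe_toNNReal (hne y)).symm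
  · exact ENNReal.continuousOn_toNNReal.comp_continuous (hfc n) hne
  · exact (ENNReal.coe_toNNReal (hne y)).le.trans ((hfn n y).trans (min_le_left _ _))

/-! ### From continuous test functions to a density in the dual ball -/

section Duality

variable {X : Type*} [MetricSpace X] [MeasurableSpace X] [BorelSpace X]

/-- Bounded `f` is approximated by continuous functions in `L^p(μ + ν)`, which controls both sides
at once since `ν` is finite. Truncation and monotone convergence then give the general case. -/
theorem lintegral_le_eLpNorm_of_forall_continuous (μ ν : Measure X) [IsFiniteMeasure μ]
    [IsFiniteMeasure ν] {p : ℝ≥0∞} (hp1 : 1 ≤ p) (hpt : p ≠ ∞)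
    (h : ∀ ρ : C(X, ℝ≥0), ∫⁻ x, ρ x ∂ν ≤ eLpNorm (fun x => (ρ x : ℝ≥0∞)) p μ)
    {f : X → ℝ≥0∞} (hf : Measurable f) : ∫⁻ x, f x ∂ν ≤ eLpNorm f p μ := by
  have hbdd : ∀ (f : X → ℝ≥0∞), Measurable f → ∀ n : ℕ, (∀ x, f x ≤ n) →
      ∫⁻ x, f x ∂ν ≤ eLpNorm f p μ := by
    intro f hf n hfn
    have hne : ∀ x, f x ≠ ∞ := fun x => ((hfn x).trans_lt (ENNReal.natCast_lt_top n)).ne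
    let F : X → ℝ := fun x => (f x).toReal
    have hFm : Measurable F := hf.ennreal_toReal
    have hfF : ∀ x, f x = ‖F x‖ₑ := fun x => by
      simp only [F]
      rw [Real.enorm_eq_ofReal ENNReal.toReal_nonneg, ENNReal.ofReal_toReal (hne x)]
    have hF : MemLp F p (μ + ν) := by
      refine MemLp.of_bound hFm.aestronglyMeasurable n (Eventually.of_forall fun x => ?_)
      rw [Real.norm_of_nonneg ENNReal.toReal_nonneg]
      exact ENNReal.toReal_le_of_le_ofReal n.cast_nonneg (by simpa using hfn x)
    -- Total error factor: `1` for the `L^p(μ)` error, and the power of `ν univ` for passing from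
    -- `L^p(ν)` to `L¹(ν)`.
    set K : ℝ≥0∞ := ν univ ^ (1 - 1 / p.toReal) + 1
    have hK : K ≠ ∞ := by
      refine ENNReal.add_ne_top.2 ⟨ENNReal.rpow_ne_top_of_nonneg ?_ (measure_ne_top _ _),
        ENNReal.one_ne_top⟩
      have : 1 ≤ p.toReal := by
        rw [← ENNReal.toReal_one]
        exact ENNReal.toReal_mono hpt hp1
      rw [sub_nonneg, div_le_one (by linarith)]
      exact this
    refine ENNReal.le_of_forall_pos_le_add fun ε hε hlt => ?_
    obtain ⟨δ, hδ, hδε⟩ : ∃ δ : ℝ≥0∞, δ ≠ 0 ∧ δ * K ≤ ε := by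
      refine ⟨ε / K, ?_, ENNReal.mul_le_of_le_div le_rfl⟩
      exact (ENNReal.div_pos (by simpa using hε.ne') hK).ne'
    obtain ⟨g, hg, -⟩ := hF.exists_boundedContinuous_eLpNorm_sub_le hpt hδ
    -- Since `F ≥ 0`, replacing `g` by its positive part does not increase the distance to `F`.
    let G : C(X, ℝ≥0) := ⟨fun x => (g x).toNNReal, continuous_real_toNNReal.comp g.continuous⟩
    have hd : ∀ x, ‖F x - G x‖ₑ ≤ ‖F x - g x‖ₑ := by
      intro x
      rw [Real.enorm_eq_ofReal_abs, Real.enorm_eq_ofReal_abs]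
      refine ENNReal.ofReal_le_ofReal ?_
      have h0 : 0 ≤ F x := ENNReal.toReal_nonneg
      simp only [G, ContinuousMap.coe_mk, Real.coe_toNNReal']
      rcases le_total (g x) 0 with h | h
      · rw [max_eq_right h, abs_of_nonneg (by linarith), abs_of_nonneg (by linarith)]
        linarith
      · rw [max_eq_left h]
    have hGm : Measurable fun x => (G x : ℝ) :=
      (NNReal.continuous_coe.comp G.continuous).measurable
    have hGe : ∀ x, (G x : ℝ≥0∞) = ‖(G x : ℝ)‖ₑ := fun x => by
      rw [Real.enorm_eq_ofReal (G x).coe_nonneg, ENNReal.ofReal_coe_nnreal]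
    have e1 : eLpNorm (fun x => F x - G x) p μ ≤ δ := by
      refine (eLpNorm_mono_enorm hd).trans ((eLpNorm_mono_measure _ ?_).trans hg)
      exact Measure.le_add_right le_rfl
    have e2 : eLpNorm (fun x => F x - G x) p ν ≤ δ := by
      refine (eLpNorm_mono_enorm hd).trans ((eLpNorm_mono_measure _ ?_).trans hg)
      exact Measure.le_add_left le_rfl
    have e3 : eLpNorm (fun x => F x - G x) 1 ν ≤ δ * ν univ ^ (1 - 1 / p.toReal) := by
      have := eLpNorm_le_eLpNorm_mul_rpow_measure_univ (μ := ν) hp1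
        (f := fun x => F x - G x) (hFm.sub hGm).aestronglyMeasurable
      refine this.trans ?_
      simp only [ENNReal.toReal_one, div_one]
      gcongr
    calc ∫⁻ x, f x ∂ν ≤ ∫⁻ x, (G x + ‖F x - G x‖ₑ) ∂ν := by
          refine lintegral_mono fun x => ?_
          rw [hGe, hfF]
          exact (enorm_add_le _ _).trans_eq' (by rw [add_sub_cancel])
      _ = ∫⁻ x, G x ∂ν + eLpNorm (fun x => F x - G x) 1 ν := by
          rw [lintegral_add_left (G.continuous.measurable.coe_nnreal_ennreal),
            eLpNorm_one_eq_lintegral_enorm]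
      _ ≤ eLpNorm (fun x => (G x : ℝ)) p μ + δ * ν univ ^ (1 - 1 / p.toReal) := by
          gcongr
          refine (h G).trans_eq (eLpNorm_congr_enorm_ae (Eventually.of_forall fun x => ?_))
          rw [← hGe, enorm_eq_self]
      _ ≤ (eLpNorm F p μ + eLpNorm (fun x => F x - G x) p μ)
            + δ * ν univ ^ (1 - 1 / p.toReal) := by
          gcongr
          have := eLpNorm_sub_le (μ := μ) hFm.aestronglyMeasurable
            (hFm.sub hGm).aestronglyMeasurable hp1
          refine le_trans (le_of_eq ?_) this
          congr 1
          funext x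
          simp
      _ ≤ eLpNorm f p μ + ε := by
          rw [add_assoc]
          refine add_le_add (eLpNorm_congr_enorm_ae (Eventually.of_forall fun x => ?_)).le ?_
          · rw [← hfF, enorm_eq_self]
          · refine le_trans ?_ hδε
            rw [mul_add, mul_one, add_comm]
            gcongr
  have hsup : ∀ x, f x = ⨆ n : ℕ, min (f x) n := fun x => by
    refine le_antisymm (le_of_forall_lt fun c hc => ?_) (iSup_le fun n => min_le_left _ _)
    obtain ⟨n, hn⟩ := ENNReal.exists_nat_gt hc.ne_top
    exact (lt_min hc hn).trans_le (le_iSup (fun n : ℕ => min (f x) n) n)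
  have : ∫⁻ x, f x ∂ν = ⨆ n : ℕ, ∫⁻ x, min (f x) n ∂ν := by
    rw [← lintegral_iSup (fun n => hf.min measurable_const) fun m n hmn x => by
      simp only; gcongr]
    exact lintegral_congr hsup
  rw [this]
  refine iSup_le fun n => (hbdd _ (hf.min measurable_const) n fun x => min_le_right _ _).trans ?_
  exact eLpNorm_mono_enorm fun x => by simp

end Duality

/-- A measure bounded by the `L^p(μ)`-norm has a density in the unit ball of `L^q(μ)`. -/
theorem exists_density_of_le_eLpNorm {X : Type*} [MeasurableSpace X] (μ ν : Measure X)
    [IsFiniteMeasure μ] [IsFiniteMeasure ν] {p q : ℝ} (hpq : p.HolderConjugate q)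
    (h : ∀ f : X → ℝ≥0∞, Measurable f → ∫⁻ x, f x ∂ν ≤ (∫⁻ x, f x ^ p ∂μ) ^ (1 / p)) :
    ∃ g : X → ℝ≥0, Measurable g ∧ ν = μ.withDensity (fun x => (g x : ℝ≥0∞)) ∧
      ∫⁻ x, (g x : ℝ≥0∞) ^ q ∂μ ≤ 1 := by
  have hac : ν ≪ μ := by
    refine Measure.AbsolutelyContinuous.mk fun s hs h0 => ?_
    have := h (s.indicator 1) (measurable_one.indicator hs)
    rw [lintegral_indicator_one hs] at this
    have h2 : ∫⁻ x, s.indicator (1 : X → ℝ≥0∞) x ^ p ∂μ = 0 := by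
      have : ∀ x, s.indicator (1 : X → ℝ≥0∞) x ^ p = s.indicator 1 x := fun x => by
        by_cases hx : x ∈ s <;> simp [hx, hpq.pos]
      simp_rw [this]
      rw [lintegral_indicator_one hs, h0]
    rw [h2, ENNReal.zero_rpow_of_pos (by simpa using hpq.pos)] at this
    exact le_antisymm this zero_le
  let g : X → ℝ≥0 := fun x => (ν.rnDeriv μ x).toNNReal
  have hgm : Measurable g := (Measure.measurable_rnDeriv ν μ).ennreal_toNNReal
  have hg : ν = μ.withDensity (fun x => (g x : ℝ≥0∞)) := by
    conv_lhs => rw [← Measure.withDensity_rnDeriv_eq ν μ hac]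
    refine withDensity_congr_ae ?_
    filter_upwards [Measure.rnDeriv_ne_top ν μ] with x hx
    exact (ENNReal.coe_toNNReal hx).symm
  refine ⟨g, hgm, hg, ?_⟩
  let G : ℕ → X → ℝ≥0∞ := fun n x => ((min (g x) n : ℝ≥0) : ℝ≥0∞)
  have hGm : ∀ n, Measurable (G n) := fun n => (hgm.min measurable_const).coe_nnreal_ennreal
  -- Test with `G^(q-1)`, whose `p`-th power is `G^q`. Since `G ≤ g`, the integral `J` of `G^q`
  -- satisfies `J ≤ J^(1/p)`, which forces `J ≤ 1` provided `J` is finite; the truncation ensures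
  -- this.
  have hb : ∀ n, ∫⁻ x, G n x ^ q ∂μ ≤ 1 := by
    intro n
    have h1 := h (fun x => G n x ^ (q - 1)) ((hGm n).pow_const _)
    have h2 : ∀ x, (G n x ^ (q - 1)) ^ p = G n x ^ q := fun x => by
      rw [← ENNReal.rpow_mul, hpq.symm.sub_one_mul_conj]
    simp_rw [h2] at h1
    rw [hg, lintegral_withDensity_eq_lintegral_mul _ hgm.coe_nnreal_ennreal
      ((hGm n).pow_const _)] at h1
    have h3 : ∫⁻ x, G n x ^ q ∂μ
        ≤ ∫⁻ x, ((fun x => (g x : ℝ≥0∞)) * fun x => G n x ^ (q - 1)) x ∂μ := by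
      refine lintegral_mono fun x => ?_
      have : G n x ^ q = G n x * G n x ^ (q - 1) := by
        conv_rhs => rw [← ENNReal.rpow_one (G n x), ← ENNReal.rpow_mul, one_mul,
          ← ENNReal.rpow_add_of_nonneg _ _ zero_le_one (sub_nonneg.2 hpq.symm.lt.le)]
        congr 1; ring
      rw [this, Pi.mul_apply]
      gcongr
      exact ENNReal.coe_le_coe.2 (min_le_left _ _)
    set J := ∫⁻ x, G n x ^ q ∂μ with hJ
    have h4 : J ≤ J ^ (1 / p) := h3.trans h1
    have hJt : J ≠ ∞ := by
      refine ((lintegral_mono (g := fun _ => (n : ℝ≥0∞) ^ q) fun x => ?_).trans_lt ?_).ne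
      · refine ENNReal.rpow_le_rpow ?_ hpq.symm.pos.le
        exact (ENNReal.coe_le_coe.2 (min_le_right _ _)).trans (by simp)
      · rw [lintegral_const]
        exact ENNReal.mul_lt_top (ENNReal.rpow_lt_top_of_nonneg hpq.symm.pos.le
          (ENNReal.natCast_ne_top n)) (measure_lt_top _ _)
    by_contra! hJ1
    have : J ^ (1 / p) < J ^ (1 : ℝ) :=
      ENNReal.rpow_lt_rpow_of_exponent_lt hJ1 hJt ((div_lt_one hpq.pos).2 hpq.lt)
    rw [ENNReal.rpow_one] at this
    exact absurd h4 (not_le.2 this)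
  have hlim : ∫⁻ x, (g x : ℝ≥0∞) ^ q ∂μ = ⨆ n, ∫⁻ x, G n x ^ q ∂μ := by
    rw [← lintegral_iSup (fun n => (hGm n).pow_const _) fun m n hmn x => by
      refine ENNReal.rpow_le_rpow ?_ hpq.symm.pos.le
      simp only [G]; gcongr]
    refine lintegral_congr fun x => le_antisymm ?_ (iSup_le fun n => ?_)
    · obtain ⟨n, hn⟩ := exists_nat_ge (g x)
      refine le_iSup_of_le n (le_of_eq ?_)
      simp only [G]
      rw [min_eq_left hn]
    · refine ENNReal.rpow_le_rpow ?_ hpq.symm.pos.le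
      exact ENNReal.coe_le_coe.2 (min_le_left _ _)
  rw [hlim]
  exact iSup_le hb

/-! ### Stability of the equality case in Hölder's inequality -/

/-- Near-equality in Young's inequality forces near-equality of `x` and `y ^ (q - 1)`. -/
theorem tendsto_rpow_of_tendsto_young_defect {p q y : ℝ} (hpq : p.HolderConjugate q)
    (hy : 0 ≤ y) {x : ℕ → ℝ} (hx : ∀ n, 0 ≤ x n)
    (h : Tendsto (fun n => x n ^ p / p + y ^ q / q - x n * y) atTop (𝓝 0)) :
    Tendsto x atTop (𝓝 (y ^ (q - 1))) := by
  -- The Young defect as a function of `a`: convex on `[0, ∞)`, nonnegative, and zero only at `y ^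
  -- (q - 1)`.
  let H : ℝ → ℝ := fun a => a ^ p / p + (y ^ q / q - a * y)
  have hH : ∀ a, H a = a ^ p / p + y ^ q / q - a * y := fun a => by simp only [H]; ring
  have hx0 : 0 ≤ y ^ (q - 1) := Real.rpow_nonneg hy _
  have hpow : (y ^ (q - 1)) ^ p = y ^ q := by
    rw [← Real.rpow_mul hy, hpq.symm.sub_one_mul_conj]
  have hmin : H (y ^ (q - 1)) = 0 := by
    rw [hH, (Real.young_inequality_eq_iff_of_nonneg hx0 hy hpq).2 hpow, sub_self]
  have hpos : ∀ a, 0 ≤ a → a ≠ y ^ (q - 1) → 0 < H a := by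
    intro a ha hne
    rw [hH, sub_pos]
    refine lt_of_le_of_ne (Real.young_inequality_of_nonneg ha hy hpq) fun heq => hne ?_
    have := (Real.young_inequality_eq_iff_of_nonneg ha hy hpq).1 heq
    exact (Real.rpow_left_inj ha hx0 hpq.ne_zero).1 (this.trans hpow.symm)
  have hconv : ConvexOn ℝ (Ici 0) H := by
    refine ConvexOn.add ?_ ?_
    · have := (convexOn_rpow hpq.lt.le).smul (inv_nonneg.2 hpq.pos.le)
      refine this.congr fun a _ => ?_
      simp only [smul_eq_mul]; ring
    · refine ⟨convex_Ici 0, fun a _ c _ s t _ _ hst => le_of_eq ?_⟩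
      simp only [smul_eq_mul]
      linear_combination (y ^ q / q) * (-hst)
  -- If `a` lay between `x n` and the minimizer, convexity would give `H a ≤ max (H (x n)) 0`; but
  -- `H a > 0` is fixed while `H (x n)` tends to zero. So `x n` cannot stay beyond `a`.
  have key : ∀ a, 0 ≤ a → a ≠ y ^ (q - 1) → ∀ᶠ n in atTop, a ∉ segment ℝ (x n) (y ^ (q - 1)) := by
    intro a ha hne
    filter_upwards [h.eventually (gt_mem_nhds (hpos a ha hne))] with n hn hmem
    have := hconv.le_max_of_mem_segment (hx n) hx0 hmem
    rw [hmin, hH (x n)] at this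
    rcases le_max_iff.1 this with h1 | h1
    · exact absurd hn (not_lt.2 h1)
    · exact absurd (hpos a ha hne) (not_lt.2 h1)
  refine tendsto_order.2 ⟨fun a ha => ?_, fun a ha => ?_⟩
  · rcases lt_or_ge a 0 with h0 | h0
    · exact Eventually.of_forall fun n => h0.trans_le (hx n)
    · filter_upwards [key a h0 ha.ne] with n hn
      by_contra! hle
      exact hn (by rw [segment_eq_Icc (hle.trans ha.le)]; exact ⟨hle, ha.le⟩)
  · filter_upwards [key a (hx0.trans ha.le) ha.ne'] with n hn
    by_contra! hle
    exact hn (by rw [segment_symm, segment_eq_Icc (ha.le.trans hle)]; exact ⟨ha.le, hle⟩)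

section Stability

variable {X : Type*} [MeasurableSpace X] {μ : Measure X} {p q : ℝ}

/-- Almost extremal functions in Hölder's inequality converge almost everywhere, up to a
subsequence. -/
theorem exists_subseq_ae_tendsto_of_lintegral_mul (hpq : p.HolderConjugate q)
    {f : ℕ → X → ℝ≥0} {g : X → ℝ≥0} (hf : ∀ n, Measurable (f n)) (hg : Measurable g)
    (hfp : Tendsto (fun n => ∫⁻ x, (f n x : ℝ≥0∞) ^ p ∂μ) atTop (𝓝 1))
    (hgq : ∫⁻ x, (g x : ℝ≥0∞) ^ q ∂μ ≤ 1)
    (hfg : Tendsto (fun n => ∫⁻ x, (f n x : ℝ≥0∞) * g x ∂μ) atTop (𝓝 1)) :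
    ∃ φ : ℕ → ℕ, StrictMono φ ∧
      ∀ᵐ x ∂μ, Tendsto (fun k => f (φ k) x) atTop (𝓝 (g x ^ (q - 1))) := by
  -- The pointwise Young defect. Its integral is at most `(∫ f_n^p)/p + 1/q - ∫ f_n g`, which tends
  -- to `1/p + 1/q - 1 = 0`.
  let D : ℕ → X → ℝ := fun n x => (f n x : ℝ) ^ p / p + (g x : ℝ) ^ q / q - f n x * g x
  have hD0 : ∀ n x, 0 ≤ D n x := fun n x =>
    sub_nonneg.2 (Real.young_inequality_of_nonneg (f n x).coe_nonneg (g x).coe_nonneg hpq)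
  have hDm : ∀ n, Measurable (D n) := fun n => by
    have h1 := (hf n).coe_nnreal_real
    have h2 := hg.coe_nnreal_real
    exact (((h1.pow_const p).div_const p).add ((h2.pow_const q).div_const q)).sub (h1.mul h2)
  have hfm : ∀ n, Measurable fun x => (f n x : ℝ≥0∞) := fun n => (hf n).coe_nnreal_ennreal
  have hgm : Measurable fun x => (g x : ℝ≥0∞) := hg.coe_nnreal_ennreal
  have hrp : ∀ (a : ℝ≥0) {s : ℝ}, 0 < s →
      ENNReal.ofReal ((a : ℝ) ^ s / s) = (a : ℝ≥0∞) ^ s * ENNReal.ofReal s⁻¹ := fun a s hs => by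
    rw [div_eq_mul_inv, ENNReal.ofReal_mul (Real.rpow_nonneg a.coe_nonneg _),
      ← ENNReal.ofReal_rpow_of_nonneg a.coe_nonneg hs.le, ENNReal.ofReal_coe_nnreal]
  have hsum : ∀ n, ∫⁻ x, ENNReal.ofReal (D n x) ∂μ + ∫⁻ x, (f n x : ℝ≥0∞) * g x ∂μ
      = (∫⁻ x, (f n x : ℝ≥0∞) ^ p ∂μ) * ENNReal.ofReal p⁻¹
        + (∫⁻ x, (g x : ℝ≥0∞) ^ q ∂μ) * ENNReal.ofReal q⁻¹ := by
    intro n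
    rw [← lintegral_add_left (hDm n).ennreal_ofReal, ← lintegral_mul_const _ ((hfm n).pow_const _),
      ← lintegral_mul_const _ (hgm.pow_const _),
      ← lintegral_add_left (((hfm n).pow_const _).mul_const _)]
    refine lintegral_congr fun x => ?_
    rw [← hrp _ hpq.pos, ← hrp _ hpq.symm.pos,
      ← ENNReal.ofReal_add (div_nonneg (Real.rpow_nonneg (f n x).coe_nonneg _) hpq.pos.le)
        (div_nonneg (Real.rpow_nonneg (g x).coe_nonneg _) hpq.symm.pos.le),
      ← ENNReal.ofReal_coe_nnreal, ← ENNReal.ofReal_coe_nnreal,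
      ← ENNReal.ofReal_mul (f n x).coe_nonneg,
      ← ENNReal.ofReal_add (hD0 n x) (mul_nonneg (f n x).coe_nonneg (g x).coe_nonneg)]
    congr 1
    simp only [D]; ring
  have hDlim : Tendsto (fun n => ∫⁻ x, ENNReal.ofReal (D n x) ∂μ) atTop (𝓝 0) := by
    have h1 : Tendsto (fun n => ((∫⁻ x, (f n x : ℝ≥0∞) ^ p ∂μ) * ENNReal.ofReal p⁻¹
        + ENNReal.ofReal q⁻¹) - ∫⁻ x, (f n x : ℝ≥0∞) * g x ∂μ) atTop
        (𝓝 ((1 * ENNReal.ofReal p⁻¹ + ENNReal.ofReal q⁻¹) - 1)) := by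
      refine ENNReal.Tendsto.sub (Tendsto.add (ENNReal.Tendsto.mul_const hfp ?_)
        tendsto_const_nhds) hfg ?_
      · simp
      · simp
    have h0 : (1 * ENNReal.ofReal p⁻¹ + ENNReal.ofReal q⁻¹) - 1 = 0 := by
      rw [one_mul, ← ENNReal.ofReal_add (inv_nonneg.2 hpq.pos.le) (inv_nonneg.2 hpq.symm.pos.le),
        hpq.inv_add_inv_eq_one]
      simp
    rw [h0] at h1
    refine tendsto_of_tendsto_of_tendsto_of_le_of_le' tendsto_const_nhds h1
      (Eventually.of_forall fun _ => zero_le) ?_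
    filter_upwards [hfg.eventually (gt_mem_nhds ENNReal.one_lt_top)] with n hn
    refine ENNReal.le_sub_of_add_le_right hn.ne ((hsum n).le.trans ?_)
    gcongr
    exact mul_le_of_le_one_left zero_le hgq
  have hmeas : TendstoInMeasure μ D atTop (fun _ => (0 : ℝ)) := by
    refine tendstoInMeasure_of_tendsto_eLpNorm one_ne_zero
      (fun n => (hDm n).aestronglyMeasurable) aestronglyMeasurable_const ?_
    refine hDlim.congr fun n => ?_
    rw [eLpNorm_one_eq_lintegral_enorm]
    refine lintegral_congr fun x => ?_
    simp [Real.enorm_eq_ofReal (hD0 n x)]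
  obtain ⟨φ, hφ, hae⟩ := hmeas.exists_seq_tendsto_ae
  refine ⟨φ, hφ, hae.mono fun x hx => ?_⟩
  have := tendsto_rpow_of_tendsto_young_defect hpq (g x).coe_nonneg (fun k => (f (φ k) x).2) hx
  rw [← NNReal.tendsto_coe]
  simpa using this

/-- Almost everywhere convergence and convergence of norms imply strong convergence (of the
positive parts). -/
theorem tendsto_lintegral_sub_rpow (hp : 1 ≤ p) {f : ℕ → X → ℝ≥0} {G : X → ℝ≥0}
    (hf : ∀ n, Measurable (f n)) (hG : Measurable G)
    (hfp : Tendsto (fun n => ∫⁻ x, (f n x : ℝ≥0∞) ^ p ∂μ) atTop (𝓝 (∫⁻ x, (G x : ℝ≥0∞) ^ p ∂μ)))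
    (hGp : ∫⁻ x, (G x : ℝ≥0∞) ^ p ∂μ ≠ ∞)
    (hae : ∀ᵐ x ∂μ, Tendsto (fun n => f n x) atTop (𝓝 (G x))) :
    Tendsto (fun n => ∫⁻ x, ((f n x : ℝ≥0∞) - G x) ^ p ∂μ) atTop (𝓝 0) := by
  have hp0 : 0 < p := one_pos.trans_le hp
  -- With `m = min f G`, superadditivity of the `p`-th power gives `(f - G)₊^p + m^p ≤ f^p`.
  -- Dominated convergence, with majorant `G^p`, shows that the integrals of `m^p` and of `f^p` have
  -- the same limit.
  let m : ℕ → X → ℝ≥0∞ := fun n x => ((min (f n x) (G x) : ℝ≥0) : ℝ≥0∞)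
  have hmm : ∀ n, Measurable (m n) := fun n => ((hf n).min hG).coe_nnreal_ennreal
  have hmle : ∀ n x, m n x ≤ G x := fun n x => ENNReal.coe_le_coe.2 (min_le_right _ _)
  have hmlim : Tendsto (fun n => ∫⁻ x, m n x ^ p ∂μ) atTop (𝓝 (∫⁻ x, (G x : ℝ≥0∞) ^ p ∂μ)) := by
    refine tendsto_lintegral_of_dominated_convergence _ (fun n => (hmm n).pow_const _)
      (fun n => Eventually.of_forall fun x => ENNReal.rpow_le_rpow (hmle n x) hp0.le) hGp ?_
    filter_upwards [hae] with x hx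
    have h1 : Tendsto (fun n => min (f n x) (G x)) atTop (𝓝 (G x)) := by
      simpa using hx.min (tendsto_const_nhds (x := G x))
    exact (ENNReal.continuous_rpow_const.tendsto _).comp (ENNReal.tendsto_coe.2 h1)
  have hsub : Tendsto (fun n => ∫⁻ x, (f n x : ℝ≥0∞) ^ p ∂μ - ∫⁻ x, m n x ^ p ∂μ) atTop (𝓝 0) := by
    have := ENNReal.Tendsto.sub hfp hmlim (Or.inl hGp)
    rwa [tsub_self] at this
  refine tendsto_of_tendsto_of_tendsto_of_le_of_le tendsto_const_nhds hsub
    (fun _ => zero_le) fun n => ?_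
  refine ENNReal.le_sub_of_add_le_right ?_ ?_
  · exact ((lintegral_mono fun x => ENNReal.rpow_le_rpow (hmle n x) hp0.le).trans_lt
      (lt_top_iff_ne_top.2 hGp)).ne
  · rw [← lintegral_add_right _ ((hmm n).pow_const _)]
    refine lintegral_mono fun x => ?_
    refine (ENNReal.add_rpow_le_rpow_add _ _ hp).trans (ENNReal.rpow_le_rpow ?_ hp0.le)
    rw [← ENNReal.coe_sub, ← ENNReal.coe_add, ENNReal.coe_le_coe]
    rcases le_total (f n x) (G x) with h | h
    · simp [tsub_eq_zero_of_le h, h]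
    · simp [tsub_add_cancel_of_le h, h]

end Stability

/-! ### Exceptional families of curves and Fuglede's lemma -/

section Exceptional

variable {X : Type*} [MetricSpace X] [MeasurableSpace X] [BorelSpace X] {μ : Measure X} {p q : ℝ}

/-- Every multiple `H / n` is still admissible for this family, and its energy tends to zero. -/
theorem modulus_eq_zero_of_lineIntegral_eq_top (hp : 0 < p) {H : X → ℝ≥0∞} (hH : Measurable H)
    (hHp : ∫⁻ x, H x ^ p ∂μ ≠ ∞) :
    modulus μ p {γ : Curv X | lineIntegral H γ = ∞} (fun _ => 1) = 0 := by
  have hle : ∀ n : ℕ, modulus μ p {γ : Curv X | lineIntegral H γ = ∞} (fun _ => 1)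
      ≤ ((n : ℝ≥0∞)⁻¹) ^ p * ∫⁻ x, H x ^ p ∂μ := by
    intro n
    have hadm : IsAdmissible {γ : Curv X | lineIntegral H γ = ∞} (fun _ => 1)
        (fun x => (n : ℝ≥0∞)⁻¹ * H x) := by
      refine ⟨hH.const_mul _, fun γ => ?_⟩
      rw [lineIntegral_const_mul _ hH, show lineIntegral H γ = ∞ from γ.2, ENNReal.mul_top]
      · exact le_top
      · simp
    refine (iInf₂_le _ hadm).trans (le_of_eq ?_)
    rw [← lintegral_const_mul _ (hH.pow_const _)]
    exact lintegral_congr fun x => ENNReal.mul_rpow_of_nonneg _ _ hp.le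
  have h1 : Tendsto (fun n : ℕ => ((n : ℝ≥0∞)⁻¹) ^ p) atTop (𝓝 (0 ^ p)) :=
    (ENNReal.continuous_rpow_const.tendsto _).comp ENNReal.tendsto_inv_nat_nhds_zero
  rw [ENNReal.zero_rpow_of_pos hp] at h1
  have h2 := ENNReal.Tendsto.mul_const h1 (Or.inr hHp)
  rw [zero_mul] at h2
  exact le_antisymm (ge_of_tendsto' h2 hle) zero_le

/-- **Fuglede's lemma**: functions that tend to zero in `L^p` have, along a subsequence, curve
integrals tending to zero for `p`-almost every curve. -/
theorem exists_subseq_tendsto_lineIntegral (hp : 0 < p) {h : ℕ → X → ℝ≥0∞}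
    (hm : ∀ n, Measurable (h n))
    (hlim : Tendsto (fun n => ∫⁻ x, h n x ^ p ∂μ) atTop (𝓝 0)) :
    ∃ φ : ℕ → ℕ, ∃ E : Set (Curv X), modulus μ p E (fun _ => 1) = 0 ∧
      ∀ γ ∉ E, Tendsto (fun k => lineIntegral (h (φ k)) γ) atTop (𝓝 0) := by
  have h2 : ∀ k : ℕ, (2 : ℝ≥0∞) ^ k ≠ 0 ∧ (2 : ℝ≥0∞) ^ k ≠ ∞ := fun k => ⟨by simp, by simp⟩
  have hex : ∀ k : ℕ, ∃ n, ((2 : ℝ≥0∞) ^ k) ^ p * ∫⁻ x, h n x ^ p ∂μ ≤ (2⁻¹) ^ k := by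
    intro k
    have : Tendsto (fun n => ((2 : ℝ≥0∞) ^ k) ^ p * ∫⁻ x, h n x ^ p ∂μ) atTop
        (𝓝 (((2 : ℝ≥0∞) ^ k) ^ p * 0)) :=
      ENNReal.Tendsto.const_mul hlim
        (Or.inr (ENNReal.rpow_ne_top_of_nonneg hp.le (h2 k).2))
    rw [mul_zero] at this
    obtain ⟨n, hn⟩ := (this.eventually (gt_mem_nhds
      (show (0 : ℝ≥0∞) < 2⁻¹ ^ k from ENNReal.pow_pos (by simp) k))).exists
    exact ⟨n, hn.le⟩
  choose φ hφ using hex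
  -- A supremum instead of a sum: `H^p` is bounded by the sum of the `p`-th powers, so `H ∈ L^p`
  -- without Minkowski's inequality. Off the family where `∫_γ H ds = ∞`, the integrals of `h (φ k)`
  -- decay like `2^(-k)`.
  let H : X → ℝ≥0∞ := fun x => ⨆ k, (2 : ℝ≥0∞) ^ k * h (φ k) x
  have hHm : Measurable H := Measurable.iSup fun k => (hm _).const_mul _
  have hHp : ∫⁻ x, H x ^ p ∂μ ≠ ∞ := by
    have hle : ∀ x, H x ^ p ≤ ∑' k, ((2 : ℝ≥0∞) ^ k) ^ p * h (φ k) x ^ p := by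
      intro x
      rw [← ENNReal.le_rpow_inv_iff hp]
      refine iSup_le fun k => ?_
      rw [ENNReal.le_rpow_inv_iff hp, ENNReal.mul_rpow_of_nonneg _ _ hp.le]
      exact ENNReal.le_tsum k
    refine ((lintegral_mono hle).trans_lt ?_).ne
    rw [lintegral_tsum fun k => (((hm _).pow_const _).const_mul _).aemeasurable]
    simp_rw [lintegral_const_mul _ ((hm _).pow_const p)]
    refine (ENNReal.tsum_le_tsum hφ).trans_lt ?_
    rw [ENNReal.tsum_geometric, ENNReal.one_sub_inv_two, inv_inv]
    exact ENNReal.ofNat_lt_top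
  refine ⟨φ, {γ | lineIntegral H γ = ∞}, modulus_eq_zero_of_lineIntegral_eq_top hp hHm hHp,
    fun γ hγ => ?_⟩
  have hle : ∀ k, lineIntegral (h (φ k)) γ ≤ (2⁻¹) ^ k * lineIntegral H γ := by
    intro k
    rw [← lineIntegral_const_mul _ hHm]
    refine lineIntegral_mono (fun x => ?_) γ
    rw [← ENNReal.inv_pow, ← ENNReal.mul_le_iff_le_inv (h2 k).1 (h2 k).2]
    exact le_iSup (fun k => (2 : ℝ≥0∞) ^ k * h (φ k) x) k
  have hz : Tendsto (fun k : ℕ => (2⁻¹ : ℝ≥0∞) ^ k * lineIntegral H γ) atTop (𝓝 0) := by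
    have := ENNReal.Tendsto.mul_const (b := lineIntegral H γ)
      (ENNReal.tendsto_pow_atTop_nhds_zero_of_lt_one (r := 2⁻¹) (by simp)) (Or.inr hγ)
    rwa [zero_mul] at this
  exact tendsto_of_tendsto_of_tendsto_of_le_of_le tendsto_const_nhds hz (fun _ => zero_le) hle

/-- `L^p`-limits of admissible functions are weakly admissible. -/
theorem isWeaklyAdmissible_of_tendsto (hp : 0 < p) {Γ : Set (Curv X)} {b : Γ → ℝ}
    {f : ℕ → X → ℝ≥0∞} {ρ : X → ℝ≥0∞} (hf : ∀ n, IsAdmissible Γ b (f n)) (hρ : Measurable ρ)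
    (hlim : Tendsto (fun n => ∫⁻ x, (f n x - ρ x) ^ p ∂μ) atTop (𝓝 0)) :
    IsWeaklyAdmissible μ p Γ b ρ := by
  obtain ⟨φ, E, hE, hφ⟩ := exists_subseq_tendsto_lineIntegral hp
    (fun n => (hf n).1.sub hρ) hlim
  refine ⟨hρ, E, hE, fun γ hγ => ?_⟩
  have h1 : ∀ k, ENNReal.ofReal (b γ) ≤
      lineIntegral ρ γ + lineIntegral (fun x => f (φ k) x - ρ x) γ := by
    intro k
    rw [← lineIntegral_add hρ]
    exact ((hf (φ k)).2 γ).trans (lineIntegral_mono (fun x => le_add_tsub) _)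
  have h2 := (hφ γ hγ).const_add (lineIntegral ρ (γ : Curv X))
  rw [add_zero] at h2
  exact ge_of_tendsto' h2 h1

/-- `p`-exceptional families of curves are null for measures in the unit ball of the dual. -/
theorem measure_eq_zero_of_modulus_eq_zero (hp : 0 < p) {Γ : Set (Curv X)} {η : Measure Γ}
    (hη : ∀ ρ : X → ℝ≥0∞, Measurable ρ →
      ∫⁻ γ : Γ, lineIntegral ρ (γ : Curv X) ∂η ≤ (∫⁻ x, ρ x ^ p ∂μ) ^ (1 / p))
    {E : Set (Curv X)} (hE : modulus μ p E (fun _ => 1) = 0) :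
    η {γ | (γ : Curv X) ∈ E} = 0 := by
  have hle : ∀ ρ, IsAdmissible E (fun _ => 1) ρ →
      η {γ | (γ : Curv X) ∈ E} ^ p ≤ ∫⁻ x, ρ x ^ p ∂μ := by
    intro ρ hρ
    rw [← ENNReal.le_rpow_inv_iff hp, ← one_div]
    refine le_trans ?_ (hη ρ hρ.1)
    have hm : Measurable fun γ : Γ => lineIntegral ρ (γ : Curv X) :=
      (measurable_lineIntegral hρ.1).comp measurable_subtype_coe
    -- Chebyshev's inequality. `E` need not be measurable, but it lies in the measurable set where
    -- `∫_γ ρ ds ≥ 1`.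
    refine (measure_mono fun γ hγ => ?_).trans
      ((mul_meas_ge_le_lintegral hm 1).trans' (one_mul _).ge)
    simpa using hρ.2 ⟨γ, hγ⟩
  have : η {γ | (γ : Curv X) ∈ E} ^ p ≤ modulus μ p E (fun _ => 1) := le_iInf₂ hle
  rw [hE, nonpos_iff_eq_zero, ENNReal.rpow_eq_zero_iff] at this
  rcases this with h | h
  · exact h.1
  · exact absurd h.2 (not_lt.2 hp.le)

end Exceptional

/-! ### Lagrange multipliers by Hahn–Banach and Riesz representation -/

/-- A linear functional on `C(Y)` that is nonnegative on nonnegative functions is the integral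
against a finite Radon measure. -/
theorem exists_radonMeasure_of_nonneg {Y : Type*} [TopologicalSpace Y] [CompactSpace Y] [T2Space Y]
    [MeasurableSpace Y] [BorelSpace Y] (Λ : C(Y, ℝ) →ₗ[ℝ] ℝ) (hΛ : ∀ f, 0 ≤ f → 0 ≤ Λ f) :
    ∃ η ∈ radonMeasures Y, ∀ f : C(Y, ℝ), ∫ y, f y ∂η = Λ f := by
  let L : CompactlySupportedContinuousMap Y ℝ →ₗ[ℝ] ℝ :=
    { toFun := fun f => Λ f.toContinuousMap
      map_add' := fun f g => by rw [← map_add]; rfl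
      map_smul' := fun c f => by rw [RingHom.id_apply, ← map_smul]; rfl }
  let P := PositiveLinearMap.mk₀ L fun f hf =>
    hΛ _ (ContinuousMap.le_def.2 fun y => CompactlySupportedContinuousMap.le_def.1 hf y)
  refine ⟨RealRMK.rieszMeasure P, ⟨inferInstance, inferInstance⟩, fun f => ?_⟩
  exact RealRMK.integral_rieszMeasure P (CompactlySupportedContinuousMap.continuousMapEquiv f)

/-- The dual problem of `inf {N s | b ≤ A s}`: a Lagrange multiplier exists if the penalized
problem `inf {N s + M m | b ≤ A s + m}` is bounded below by `V`. -/
theorem exists_multiplier {Y S : Type*} [TopologicalSpace Y] [CompactSpace Y] [T2Space Y]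
    [MeasurableSpace Y] [BorelSpace Y] [AddCommMonoid S] [Module ℝ≥0 S]
    (A : S → Y → ℝ≥0∞) (A_add : ∀ s t y, A (s + t) y = A s y + A t y)
    (A_smul : ∀ (c : ℝ≥0) s y, A (c • s) y = c * A s y)
    (N : S → ℝ≥0) (N_add : ∀ s t, N (s + t) ≤ N s + N t)
    (N_smul : ∀ (c : ℝ≥0) s, N (c • s) = c * N s)
    (M : ℝ≥0) (b : C(Y, ℝ)) (V : ℝ)
    (hV : ∀ (s : S) (m : ℝ≥0), (∀ y, ENNReal.ofReal (b y) ≤ A s y + m) → V ≤ N s + M * m) :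
    ∃ η ∈ radonMeasures Y, η univ ≤ M ∧ V ≤ ∫ y, b y ∂η ∧
      ∀ (s : S) (f : C(Y, ℝ≥0)), (∀ y, (f y : ℝ≥0∞) ≤ A s y) → ∫⁻ y, f y ∂η ≤ N s := by
  -- The attainable values of the penalized problem with `f` in place of `b`. The slack `m` makes
  -- every `f` feasible, so the infimum `Q` is finite on all of `C(Y)`; no continuity of `A s` is
  -- needed.
  let P : C(Y, ℝ) → Set ℝ := fun f =>
    {r | ∃ (s : S) (m : ℝ≥0), (∀ y, ENNReal.ofReal (f y) ≤ A s y + m) ∧ r = N s + M * m}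
  let Q : C(Y, ℝ) → ℝ := fun f => sInf (P f)
  have hP0 : ∀ f, ∀ r ∈ P f, 0 ≤ r := by
    rintro f _ ⟨s, m, -, rfl⟩; positivity
  have hbdd : ∀ f, BddBelow (P f) := fun f => ⟨0, fun r hr => hP0 f r hr⟩
  have hne : ∀ f, (P f).Nonempty := fun f => ⟨_, 0, ‖f‖₊, fun y => by
    refine le_add_left ?_
    rw [← ENNReal.ofReal_coe_nnreal]
    exact ENNReal.ofReal_le_ofReal ((le_abs_self _).trans (f.norm_coe_le_norm y)), rfl⟩
  have hQ0 : ∀ f, 0 ≤ Q f := fun f => le_csInf (hne f) (hP0 f)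
  have hsmul_le : ∀ c : ℝ, 0 < c → ∀ f, Q (c • f) ≤ c * Q f := by
    intro c hc f
    rw [← div_le_iff₀' hc]
    refine le_csInf (hne f) ?_
    rintro _ ⟨s, m, hs, rfl⟩
    rw [div_le_iff₀' hc]
    lift c to ℝ≥0 using hc.le
    refine csInf_le (hbdd _) ⟨c • s, c * m, fun y => ?_, ?_⟩
    · rw [A_smul, ContinuousMap.smul_apply, smul_eq_mul, ENNReal.ofReal_mul hc.le,
        ENNReal.ofReal_coe_nnreal, ENNReal.coe_mul, ← mul_add]
      gcongr
      exact hs y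
    · rw [N_smul]; push_cast; ring
  have hsmul : ∀ c : ℝ, 0 < c → ∀ f, Q (c • f) = c * Q f := by
    intro c hc f
    refine le_antisymm (hsmul_le c hc f) ?_
    have := hsmul_le c⁻¹ (inv_pos.2 hc) (c • f)
    rwa [inv_smul_smul₀ hc.ne', ← div_eq_inv_mul, le_div_iff₀' hc] at this
  have hadd : ∀ f g, Q (f + g) ≤ Q f + Q g := by
    intro f g
    rw [← sub_le_iff_le_add]
    refine le_csInf (hne f) ?_
    rintro _ ⟨s, m, hs, rfl⟩
    rw [sub_le_comm]
    refine le_csInf (hne g) ?_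
    rintro _ ⟨t, n, ht, rfl⟩
    rw [sub_le_iff_le_add']
    refine (csInf_le (hbdd _) ⟨s + t, m + n, fun y => ?_, rfl⟩).trans ?_
    · rw [A_add, ContinuousMap.add_apply, ENNReal.coe_add, add_add_add_comm]
      exact ENNReal.ofReal_add_le.trans (add_le_add (hs y) (ht y))
    · have : (N (s + t) : ℝ) ≤ N s + N t := by exact_mod_cast N_add s t
      push_cast
      linarith
  have hVb : V ≤ Q b := le_csInf (hne b) (by rintro _ ⟨s, m, hs, rfl⟩; exact hV s m hs)
  have hN0 : N 0 = 0 := by simpa using N_smul 0 0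
  have hle : ∀ (f : C(Y, ℝ)) (m : ℝ≥0), (∀ y, f y ≤ m) → Q f ≤ M * m := fun f m hf => by
    refine csInf_le (hbdd _) ⟨0, m, fun y => le_add_left ?_, by simp [hN0]⟩
    rw [← ENNReal.ofReal_coe_nnreal]
    exact ENNReal.ofReal_le_ofReal (hf y)
  obtain ⟨Λ, hΛb, hΛQ⟩ : ∃ Λ : C(Y, ℝ) →ₗ[ℝ] ℝ, V ≤ Λ b ∧ ∀ f, Λ f ≤ Q f := by
    -- For `b = 0` one has `V ≤ Q 0 ≤ 0`, and the zero functional serves. Otherwise `c • b ↦ c * Q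
    -- b` is extended from the line through `b`; for `c ≤ 0` it is below `Q` because `Q ≥ 0`.
    rcases eq_or_ne b 0 with rfl | hb
    · have h0 : Q 0 ≤ 0 := by simpa using hle 0 0 (by simp)
      exact ⟨0, by simpa using hVb.trans h0, fun f => by simpa using hQ0 f⟩
    · obtain ⟨Λ, h1, h2⟩ := exists_extension_of_le_sublinear
        (LinearPMap.mkSpanSingleton b (Q b) hb) Q hsmul hadd (by
          rintro ⟨x, hx⟩
          obtain ⟨c, rfl⟩ := Submodule.mem_span_singleton.1 hx
          have happ : LinearPMap.mkSpanSingleton b (Q b) hb ⟨c • b, hx⟩ = c * Q b :=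
            LinearPMap.mkSpanSingleton'_apply _ _ _ _ _
          rw [happ]
          rcases lt_or_ge 0 c with hc | hc
          · exact (hsmul c hc b).ge
          · exact (mul_nonpos_of_nonpos_of_nonneg hc (hQ0 b)).trans (hQ0 _))
      refine ⟨Λ, ?_, h2⟩
      have := h1 ⟨b, Submodule.mem_span_singleton_self b⟩
      rw [LinearPMap.mkSpanSingleton_apply] at this
      exact hVb.trans this.ge
  -- Positivity: for `f ≥ 0` the pair `s = 0`, `m = 0` is feasible for `-f`, hence `Λ (-f) ≤ Q (-f)
  -- ≤ 0`.
  obtain ⟨η, hη, hηΛ⟩ := exists_radonMeasure_of_nonneg Λ fun f hf => by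
    have := (hΛQ (-f)).trans (hle (-f) 0 fun y => by simpa using ContinuousMap.le_def.1 hf y)
    simpa using this
  have := hη.1
  refine ⟨η, hη, ?_, (hηΛ b).symm ▸ hΛb, fun s f hf => ?_⟩
  -- The constant function `1` is covered by the slack `m = 1` alone, at cost `M`.
  · have h1 := (hηΛ 1).trans_le ((hΛQ 1).trans (hle 1 1 fun y => by simp))
    simp only [ContinuousMap.one_apply, integral_const, smul_eq_mul, mul_one, NNReal.coe_one] at h1
    rw [← ENNReal.ofReal_coe_nnreal]
    exact (ENNReal.le_ofReal_iff_toReal_le (measure_ne_top _ _) M.coe_nonneg).2 h1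
  · let F : C(Y, ℝ) := ⟨fun y => f y, NNReal.continuous_coe.comp f.continuous⟩
    have h1 : Λ F ≤ N s := (hΛQ F).trans (csInf_le (hbdd _) ⟨s, 0, fun y => by
      simpa [F] using hf y, by simp⟩)
    rw [← hηΛ] at h1
    have hint : Integrable (fun y => F y) η := 
      F.continuous.integrable_of_hasCompactSupport (HasCompactSupport.of_compactSpace F)
    have h2 := ofReal_integral_eq_lintegral_ofReal hint
      (Eventually.of_forall fun y => (f y).coe_nonneg)
    have h3 : ∫⁻ y, (f y : ℝ≥0∞) ∂η = ENNReal.ofReal (∫ y, F y ∂η) := by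
      rw [h2]
      exact lintegral_congr fun y => (ENNReal.ofReal_coe_nnreal).symm
    rw [h3, ← ENNReal.ofReal_coe_nnreal]
    exact ENNReal.ofReal_le_ofReal h1

/-! ### Extremal sequences; elementary bounds on norms and integrals -/

/-- Almost extremal sequences for `∫ f g ≤ ‖f‖_p`, with `g` in the unit ball of `L^q`. -/
theorem exists_subseq_ae_tendsto_of_le_lintegral_mul {X : Type*} [MeasurableSpace X]
    {μ : Measure X} {p q : ℝ} (hpq : p.HolderConjugate q) {f : ℕ → X → ℝ≥0} {g : X → ℝ≥0}
    (hf : ∀ n, Measurable (f n)) (hg : Measurable g) {V : ℝ≥0} (hV : 0 < V)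
    (hfp : Tendsto (fun n => ∫⁻ x, (f n x : ℝ≥0∞) ^ p ∂μ) atTop (𝓝 ((V : ℝ≥0∞) ^ p)))
    (hgq : ∫⁻ x, (g x : ℝ≥0∞) ^ q ∂μ ≤ 1)
    (hfg : ∀ n, (V : ℝ≥0∞) ≤ ∫⁻ x, (f n x : ℝ≥0∞) * g x ∂μ) :
    ∫⁻ x, (g x : ℝ≥0∞) ^ q ∂μ = 1 ∧ ∃ φ : ℕ → ℕ, StrictMono φ ∧
      ∀ᵐ x ∂μ, Tendsto (fun k => f (φ k) x) atTop (𝓝 (V * g x ^ (q - 1))) := by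
  have hV0 : (V : ℝ≥0∞) ≠ 0 := by simpa using hV.ne'
  have hVi : ((V⁻¹ : ℝ≥0) : ℝ≥0∞) = (V : ℝ≥0∞)⁻¹ := ENNReal.coe_inv hV.ne'
  let u : ℕ → X → ℝ≥0 := fun n x => V⁻¹ * f n x
  have hum : ∀ n, Measurable (u n) := fun n => (hf n).const_mul _
  have hgm : Measurable fun x => (g x : ℝ≥0∞) := hg.coe_nnreal_ennreal
  have hup : ∀ n, ∫⁻ x, (u n x : ℝ≥0∞) ^ p ∂μ
      = ((V : ℝ≥0∞)⁻¹) ^ p * ∫⁻ x, (f n x : ℝ≥0∞) ^ p ∂μ := fun n => by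
    rw [← lintegral_const_mul _ ((hf n).coe_nnreal_ennreal.pow_const _)]
    refine lintegral_congr fun x => ?_
    simp only [u]
    rw [ENNReal.coe_mul, hVi, ENNReal.mul_rpow_of_nonneg _ _ hpq.pos.le]
  have hug : ∀ n, 1 ≤ ∫⁻ x, (u n x : ℝ≥0∞) * g x ∂μ := fun n => by
    have : ∫⁻ x, (u n x : ℝ≥0∞) * g x ∂μ = (V : ℝ≥0∞)⁻¹ * ∫⁻ x, (f n x : ℝ≥0∞) * g x ∂μ := by
      have hm : Measurable fun x => (f n x : ℝ≥0∞) * g x := (hf n).coe_nnreal_ennreal.mul hgm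
      rw [← lintegral_const_mul _ hm]
      refine lintegral_congr fun x => ?_
      simp only [u]
      rw [ENNReal.coe_mul, hVi, mul_assoc]
    rw [this, ← ENNReal.inv_mul_cancel hV0 ENNReal.coe_ne_top]
    gcongr
    exact hfg n
  have hulim : Tendsto (fun n => ∫⁻ x, (u n x : ℝ≥0∞) ^ p ∂μ) atTop (𝓝 1) := by
    simp_rw [hup]
    have := ENNReal.Tendsto.const_mul (a := ((V : ℝ≥0∞)⁻¹) ^ p) hfp
      (Or.inr (ENNReal.rpow_ne_top_of_nonneg hpq.pos.le (by simpa using hV.ne')))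
    rwa [← ENNReal.mul_rpow_of_nonneg _ _ hpq.pos.le,
      ENNReal.inv_mul_cancel hV0 ENNReal.coe_ne_top, ENNReal.one_rpow] at this
  have hupl : Tendsto (fun n => (∫⁻ x, (u n x : ℝ≥0∞) ^ p ∂μ) ^ (1 / p)) atTop (𝓝 1) := by
    have := (ENNReal.continuous_rpow_const (y := 1 / p)).tendsto _ |>.comp hulim
    rwa [ENNReal.one_rpow] at this
  have hholder : ∀ n, ∫⁻ x, (u n x : ℝ≥0∞) * g x ∂μ
      ≤ (∫⁻ x, (u n x : ℝ≥0∞) ^ p ∂μ) ^ (1 / p) * (∫⁻ x, (g x : ℝ≥0∞) ^ q ∂μ) ^ (1 / q) :=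
    fun n => ENNReal.lintegral_mul_le_Lp_mul_Lq μ hpq
      (hum n).coe_nnreal_ennreal.aemeasurable hgm.aemeasurable
  have hgq' : (∫⁻ x, (g x : ℝ≥0∞) ^ q ∂μ) ^ (1 / q) ≤ 1 :=
    ENNReal.rpow_le_one hgq (one_div_nonneg.2 hpq.symm.pos.le)
  constructor
  -- In the limit, `1 ≤ ‖u_n‖_p ‖g‖_q` with `‖u_n‖_p → 1` leaves no room for `‖g‖_q < 1`.
  · refine le_antisymm hgq ?_
    have h1 := ENNReal.Tendsto.mul_const (b := (∫⁻ x, (g x : ℝ≥0∞) ^ q ∂μ) ^ (1 / q)) hupl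
      (Or.inl one_ne_zero)
    have h2 := ge_of_tendsto' h1 fun n => (hug n).trans (hholder n)
    rw [one_mul] at h2
    by_contra! hlt
    exact absurd h2 (not_le.2 (ENNReal.rpow_lt_one hlt (one_div_pos.2 hpq.symm.pos)))
  · obtain ⟨φ, hφ, hae⟩ := exists_subseq_ae_tendsto_of_lintegral_mul hpq hum hg hulim hgq
      (tendsto_of_tendsto_of_tendsto_of_le_of_le tendsto_const_nhds hupl hug
        fun n => (hholder n).trans (mul_le_of_le_one_right zero_le hgq'))
    refine ⟨φ, hφ, hae.mono fun x hx => ?_⟩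
    have := hx.const_mul V
    refine this.congr fun k => ?_
    simp only [u]
    rw [← mul_assoc, mul_inv_cancel₀ hV.ne', one_mul]

theorem eLpNorm_ofReal_eq {X : Type*} [MeasurableSpace X] (μ : Measure X) {p : ℝ} (hp : 0 < p)
    (f : X → ℝ≥0∞) : eLpNorm f (ENNReal.ofReal p) μ = (∫⁻ x, f x ^ p ∂μ) ^ (1 / p) := by
  rw [eLpNorm_eq_lintegral_rpow_enorm_toReal (by simpa using hp) ENNReal.ofReal_ne_top,
    ENNReal.toReal_ofReal hp.le]
  simp only [enorm_eq_self]

theorem eLpNorm_coe_ne_top {X : Type*} [TopologicalSpace X] [CompactSpace X] [MeasurableSpace X]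
    (μ : Measure X) [IsFiniteMeasure μ] {p : ℝ} (hp : 0 < p) (ρ : C(X, ℝ≥0)) :
    eLpNorm (fun x => (ρ x : ℝ≥0∞)) (ENNReal.ofReal p) μ ≠ ∞ := by
  rw [eLpNorm_ofReal_eq μ hp]
  refine ENNReal.rpow_ne_top_of_nonneg (one_div_nonneg.2 hp.le) (ne_of_lt ?_)
  obtain ⟨C, hC⟩ := isCompact_univ.exists_bound_of_continuousOn
    (NNReal.continuous_coe.comp ρ.continuous).continuousOn
  refine (lintegral_mono (g := fun _ => ENNReal.ofReal C ^ p) fun x => ?_).trans_lt ?_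
  · refine ENNReal.rpow_le_rpow ?_ hp.le
    rw [← ENNReal.ofReal_coe_nnreal]
    exact ENNReal.ofReal_le_ofReal ((le_abs_self _).trans (hC x (mem_univ x)))
  · rw [lintegral_const]
    exact ENNReal.mul_lt_top (ENNReal.rpow_lt_top_of_nonneg hp.le ENNReal.ofReal_ne_top)
      (measure_lt_top _ _)

theorem ofReal_integral_le_lintegral {X : Type*} [MetricSpace X] {Γ : Set (Curv X)} {b : C(Γ, ℝ)}
    [CompactSpace Γ] (hb : ∀ γ, 0 ≤ b γ) {η : Measure Γ} [IsFiniteMeasure η] {ρ : X → ℝ≥0∞}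
    (h : ∀ᵐ γ : Γ ∂η, ENNReal.ofReal (b γ) ≤ lineIntegral ρ (γ : Curv X)) :
    ENNReal.ofReal (∫ γ, b γ ∂η) ≤ ∫⁻ γ : Γ, lineIntegral ρ (γ : Curv X) ∂η := by
  rw [ofReal_integral_eq_lintegral_ofReal
    (b.continuous.integrable_of_hasCompactSupport (HasCompactSupport.of_compactSpace _))
    (Eventually.of_forall hb)]
  exact lintegral_mono_ae h

theorem rpow_contModulus_le {X : Type*} [MetricSpace X] [MeasurableSpace X] {μ : Measure X}
    {p : ℝ} {Γ : Set (Curv X)} (hp : 0 < p) {b : Γ → ℝ} (ρ : C(X, ℝ≥0))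
    (hρ : IsAdmissible Γ b fun x => (ρ x : ℝ≥0∞)) :
    contModulus μ p Γ b ^ (1 / p) ≤ (∫⁻ x, (ρ x : ℝ≥0∞) ^ p ∂μ) ^ (1 / p) :=
  ENNReal.rpow_le_rpow (iInf₂_le ρ hρ) (one_div_nonneg.2 hp.le)

/-! ### The optimal measure of the dual problem -/

section Dual

variable {X : Type*} [MetricSpace X] [MeasurableSpace X] [BorelSpace X] {μ : Measure X} {p q : ℝ}
  {Γ : Set (Curv X)}

theorem lintegral_lineIntegral_of_density {η : Measure Γ} {g : X → ℝ≥0∞} (hg : Measurable g)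
    (hη : projectedMeasure η = μ.withDensity g) {ρ : X → ℝ≥0∞} (hρ : Measurable ρ) :
    ∫⁻ γ : Γ, lineIntegral ρ (γ : Curv X) ∂η = ∫⁻ x, ρ x * g x ∂μ := by
  rw [← lintegral_projectedMeasure η hρ, hη, lintegral_withDensity_eq_lintegral_mul _ hg hρ]
  exact lintegral_congr fun x => mul_comm _ _

theorem lintegral_lineIntegral_le (hpq : p.HolderConjugate q) {η : Measure Γ}
    (hη : η ∈ barycenterClass μ q Γ) {ρ : X → ℝ≥0∞} (hρ : Measurable ρ) :
    ∫⁻ γ : Γ, lineIntegral ρ (γ : Curv X) ∂η ≤ (∫⁻ x, ρ x ^ p ∂μ) ^ (1 / p) := by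
  obtain ⟨-, g, hg, hd, hgq⟩ := hη
  rw [lintegral_lineIntegral_of_density hg hd hρ]
  rw [eLpNorm_ofReal_eq μ hpq.symm.pos] at hgq
  exact (ENNReal.lintegral_mul_le_Lp_mul_Lq μ hpq hρ.aemeasurable hg.aemeasurable).trans
    (mul_le_of_le_one_right zero_le hgq)

theorem ofReal_integral_le_rpow_lintegral (hpq : p.HolderConjugate q) {b : C(Γ, ℝ)}
    [CompactSpace Γ] (hb : ∀ γ, 0 ≤ b γ) {η : Measure Γ} (hη : η ∈ barycenterClass μ q Γ)
    {ρ : X → ℝ≥0∞} (hρ : IsAdmissible Γ b ρ) :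
    ENNReal.ofReal (∫ γ, b γ ∂η) ≤ (∫⁻ x, ρ x ^ p ∂μ) ^ (1 / p) := by
  have := hη.1.1
  exact (ofReal_integral_le_lintegral hb (Eventually.of_forall hρ.2)).trans
    (lintegral_lineIntegral_le hpq hη hρ.1)

/-- Relaxing the constraint by `m` does not lower the value, if violations are penalized with
the factor `V / inf b`. -/
theorem le_add_penalty [CompactSpace X] [IsFiniteMeasure μ] (hp : 0 < p) {b : Γ → ℝ} {β : ℝ}
    (hβ : 0 < β) (hb : ∀ γ, β ≤ b γ) {V : ℝ}
    (hV0 : 0 ≤ V) (hV : contModulus μ p Γ b ^ (1 / p) = ENNReal.ofReal V) (ρ : C(X, ℝ≥0))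
    (hN : (∫⁻ x, (ρ x : ℝ≥0∞) ^ p ∂μ) ^ (1 / p) ≠ ∞) (m : ℝ≥0)
    (h : ∀ γ : Γ, ENNReal.ofReal (b γ) ≤ lineIntegral (fun x => (ρ x : ℝ≥0∞)) (γ : Curv X) + m) :
    V ≤ ((∫⁻ x, (ρ x : ℝ≥0∞) ^ p ∂μ) ^ (1 / p)).toReal + V / β * m := by
  -- If `m ≥ β`, the penalty alone is already at least `V`.
  rcases le_or_gt β m with hm | hm
  · refine le_add_of_nonneg_of_le ENNReal.toReal_nonneg ?_
    rw [div_mul_eq_mul_div, le_div_iff₀ hβ]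
    gcongr
  set N := (∫⁻ x, (ρ x : ℝ≥0∞) ^ p ∂μ) ^ (1 / p) with hNdef
  -- Since `b ≥ β`, one has `b - m ≥ t b` for `t = 1 - m/β`. Thus `ρ / t` is admissible, so `t V ≤
  -- ‖ρ‖_p`, and `V = t V + (V/β) m`.
  obtain ⟨t, ht⟩ : ∃ t : ℝ≥0, (t : ℝ) = 1 - m / β :=
    ⟨⟨1 - m / β, sub_nonneg.2 ((div_le_one hβ).2 hm.le)⟩, rfl⟩
  have htpos : 0 < t := by
    rw [← NNReal.coe_pos, ht, sub_pos, div_lt_one hβ]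
    exact hm
  have ht0 : (t : ℝ≥0∞) ≠ 0 := by simpa using htpos.ne'
  have hm' : Measurable fun x => (ρ x : ℝ≥0∞) := ρ.continuous.measurable.coe_nnreal_ennreal
  have hcoe : ∀ x, ((t⁻¹ • ρ) x : ℝ≥0∞) = (t : ℝ≥0∞)⁻¹ * ρ x := fun x => by
    rw [ContinuousMap.smul_apply, smul_eq_mul, ENNReal.coe_mul, ENNReal.coe_inv htpos.ne']
  have hadm : IsAdmissible Γ b fun x => ((t⁻¹ • ρ) x : ℝ≥0∞) := by
    refine ⟨(t⁻¹ • ρ).continuous.measurable.coe_nnreal_ennreal, fun γ => ?_⟩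
    simp_rw [hcoe]
    rw [lineIntegral_const_mul _ hm', ← ENNReal.mul_le_iff_le_inv ht0 ENNReal.coe_ne_top]
    have h1 : (t : ℝ) * b γ ≤ b γ - m := by
      rw [ht]
      have h2 : (m : ℝ) * β ≤ m * b γ := mul_le_mul_of_nonneg_left (hb γ) m.coe_nonneg
      have h3 : (m : ℝ) ≤ m / β * b γ := by rwa [div_mul_eq_mul_div, le_div_iff₀ hβ]
      linarith
    rw [← ENNReal.ofReal_coe_nnreal, ← ENNReal.ofReal_mul t.coe_nonneg]
    refine (ENNReal.ofReal_le_ofReal h1).trans ?_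
    rw [ENNReal.ofReal_sub _ m.coe_nonneg, ENNReal.ofReal_coe_nnreal]
    exact tsub_le_iff_right.2 (h γ)
  have hle := rpow_contModulus_le (μ := μ) hp _ hadm
  simp_rw [hcoe, ENNReal.mul_rpow_of_nonneg _ _ hp.le] at hle
  rw [lintegral_const_mul _ (hm'.pow_const _),
    ENNReal.mul_rpow_of_nonneg _ _ (one_div_nonneg.2 hp.le), ← ENNReal.rpow_mul,
    mul_one_div_cancel hp.ne', ENNReal.rpow_one, ← hNdef, hV,
    ← ENNReal.mul_le_iff_le_inv ht0 ENNReal.coe_ne_top, ← ENNReal.ofReal_coe_nnreal,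
    ← ENNReal.ofReal_mul t.coe_nonneg, ENNReal.ofReal_le_iff_le_toReal hN, ht] at hle
  have : V = (1 - m / β) * V + V / β * m := by ring
  linarith

/-- Existence of an optimal measure for the dual problem. -/
theorem exists_dual_measure [CompactSpace X] [IsFiniteMeasure μ] (hpq : p.HolderConjugate q)
    (hΓ : IsCompact Γ) (b : C(Γ, ℝ)) {β : ℝ} (hβ : 0 < β) (hb : ∀ γ, β ≤ b γ) {V : ℝ}
    (hV0 : 0 ≤ V) (hV : contModulus μ p Γ b ^ (1 / p) = ENNReal.ofReal V) :
    ∃ η ∈ radonMeasures Γ, η univ ≤ ENNReal.ofReal (V / β) ∧ V ≤ ∫ γ, b γ ∂η ∧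
      ∃ g : X → ℝ≥0, Measurable g ∧
        projectedMeasure η = μ.withDensity (fun x => (g x : ℝ≥0∞)) ∧
        ∫⁻ x, (g x : ℝ≥0∞) ^ q ∂μ ≤ 1 := by
  have := isCompact_iff_compactSpace.1 hΓ
  have hp1 : 1 ≤ ENNReal.ofReal p := ENNReal.one_le_ofReal.2 hpq.lt.le
  have hcm : ∀ ρ : C(X, ℝ≥0), Measurable fun x => (ρ x : ℝ≥0∞) := fun ρ =>
    ρ.continuous.measurable.coe_nnreal_ennreal
  let N : C(X, ℝ≥0) → ℝ≥0∞ := fun ρ => eLpNorm (fun x => (ρ x : ℝ≥0∞)) (ENNReal.ofReal p) μ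
  have hNeq : ∀ ρ, N ρ = (∫⁻ x, (ρ x : ℝ≥0∞) ^ p ∂μ) ^ (1 / p) := fun ρ =>
    eLpNorm_ofReal_eq μ hpq.pos _
  have hNt : ∀ ρ, N ρ ≠ ∞ := fun ρ => eLpNorm_coe_ne_top μ hpq.pos ρ
  obtain ⟨η, hη, hηM, hηV, hηN⟩ := exists_multiplier
    (fun (ρ : C(X, ℝ≥0)) (γ : Γ) => lineIntegral (fun x => (ρ x : ℝ≥0∞)) (γ : Curv X))
    (fun ρ₁ ρ₂ γ => by
      simp only [ContinuousMap.add_apply, ENNReal.coe_add]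
      exact lineIntegral_add (hcm ρ₁) _ _)
    (fun c ρ γ => by
      simp only [ContinuousMap.smul_apply, smul_eq_mul, ENNReal.coe_mul]
      exact lineIntegral_const_mul _ (hcm ρ) _)
    (fun ρ => (N ρ).toNNReal)
    (fun ρ₁ ρ₂ => by
      rw [← ENNReal.coe_le_coe, ENNReal.coe_add, ENNReal.coe_toNNReal (hNt _),
        ENNReal.coe_toNNReal (hNt _), ENNReal.coe_toNNReal (hNt _), hNeq, hNeq, hNeq]
      refine le_trans (le_of_eq ?_) (ENNReal.lintegral_Lp_add_le (hcm ρ₁).aemeasurable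
        (hcm ρ₂).aemeasurable hpq.lt.le)
      simp)
    (fun c ρ => by
      rw [← ENNReal.coe_inj, ENNReal.coe_mul, ENNReal.coe_toNNReal (hNt _),
        ENNReal.coe_toNNReal (hNt _), hNeq, hNeq]
      simp only [ContinuousMap.smul_apply, smul_eq_mul, ENNReal.coe_mul,
        ENNReal.mul_rpow_of_nonneg _ _ hpq.pos.le]
      rw [lintegral_const_mul _ ((hcm ρ).pow_const _),
        ENNReal.mul_rpow_of_nonneg _ _ (one_div_nonneg.2 hpq.pos.le), ← ENNReal.rpow_mul,
        mul_one_div_cancel hpq.pos.ne', ENNReal.rpow_one])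
    (V / β).toNNReal b V
    (fun ρ m h => by
      have := le_add_penalty hpq.pos hβ hb hV0 hV ρ (by rw [← hNeq]; exact hNt ρ) m h
      rw [← hNeq] at this
      rwa [Real.coe_toNNReal _ (div_nonneg hV0 hβ.le)])
  refine ⟨η, hη, hηM, hηV, ?_⟩
  -- The multiplier bound only concerns continuous minorants of `γ ↦ ∫_γ ρ ds`; lower semicontinuity
  -- recovers the full integral.
  have hAN : ∀ ρ : C(X, ℝ≥0), ∫⁻ x, ρ x ∂projectedMeasure η ≤ N ρ := by
    intro ρ
    rw [lintegral_projectedMeasure η (hcm ρ)]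
    refine lintegral_le_of_forall_continuous_le η
      ((lowerSemicontinuous_lineIntegral ρ).comp continuous_subtype_val) fun f hf => ?_
    have := hηN ρ f hf
    rwa [ENNReal.coe_toNNReal (hNt ρ)] at this
  -- Curve lengths are not assumed bounded on `Γ`; finiteness comes from the norm bound at `ρ = 1`.
  have hfin : IsFiniteMeasure (projectedMeasure η) := by
    refine ⟨?_⟩
    have := hAN 1
    simp only [ContinuousMap.one_apply, ENNReal.coe_one, lintegral_one] at this
    exact this.trans_lt (lt_top_iff_ne_top.2 (hNt 1))
  exact exists_density_of_le_eLpNorm μ (projectedMeasure η) hpq fun f hf =>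
    (lintegral_le_eLpNorm_of_forall_continuous μ _ hp1 ENNReal.ofReal_ne_top hAN hf).trans_eq
      (eLpNorm_ofReal_eq μ hpq.pos f)

end Dual

/-! ### Minimizing sequences and identification of the minimizer -/

section Extremal

variable {X : Type*} [MetricSpace X] [MeasurableSpace X] {μ : Measure X} {p q : ℝ}
  {Γ : Set (Curv X)}

theorem exists_minimizing_seq (b : Γ → ℝ) (hfin : contModulus μ p Γ b ≠ ∞) :
    ∃ f : ℕ → C(X, ℝ≥0), (∀ n, IsAdmissible Γ b fun x => (f n x : ℝ≥0∞)) ∧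
      Tendsto (fun n => ∫⁻ x, (f n x : ℝ≥0∞) ^ p ∂μ) atTop (𝓝 (contModulus μ p Γ b)) := by
  have hex : ∀ n : ℕ, ∃ f : C(X, ℝ≥0), IsAdmissible Γ b (fun x => (f x : ℝ≥0∞)) ∧
      ∫⁻ x, (f x : ℝ≥0∞) ^ p ∂μ < contModulus μ p Γ b + ((n : ℝ≥0∞))⁻¹ := by
    intro n
    have : contModulus μ p Γ b < contModulus μ p Γ b + ((n : ℝ≥0∞))⁻¹ :=
      ENNReal.lt_add_right hfin (by simp)
    conv at this => lhs; rw [contModulus]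
    simp only [iInf_lt_iff] at this
    obtain ⟨f, hf, hlt⟩ := this
    exact ⟨f, hf, hlt⟩
  choose f hf hlt using hex
  refine ⟨f, hf, ?_⟩
  have := ENNReal.tendsto_inv_nat_nhds_zero.const_add (contModulus μ p Γ b)
  rw [add_zero] at this
  exact tendsto_of_tendsto_of_tendsto_of_le_of_le tendsto_const_nhds this
    (fun n => iInf₂_le (f n) (hf n)) fun n => (hlt n).le

variable [BorelSpace X]

/-- Measures in the barycenter class do not charge `p`-exceptional families, so inequalities valid
for `p`-a.e. curve may be integrated against them. -/
theorem ae_le_lineIntegral_of_isWeaklyAdmissible (hpq : p.HolderConjugate q) {b : Γ → ℝ}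
    {η : Measure Γ} (hη : η ∈ barycenterClass μ q Γ) {ρ : X → ℝ≥0∞}
    (hρ : IsWeaklyAdmissible μ p Γ b ρ) :
    ∀ᵐ γ : Γ ∂η, ENNReal.ofReal (b γ) ≤ lineIntegral ρ (γ : Curv X) := by
  obtain ⟨-, E, hE, hle⟩ := hρ
  have h0 := measure_eq_zero_of_modulus_eq_zero hpq.pos
    (fun ρ hρ => lintegral_lineIntegral_le hpq hη hρ) hE
  exact measure_mono_null (fun γ hγ => by_contra fun h => hγ (hle γ h)) h0

/-- A function of norm at most `V` on which `g`, in the unit ball of `L^q`, takes a value at least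
`V` is the extremal one. -/
theorem ae_eq_of_le_lintegral_mul {X : Type*} [MeasurableSpace X] {μ : Measure X}
    (hpq : p.HolderConjugate q) {g : X → ℝ≥0} (hg : Measurable g)
    (hgq : ∫⁻ x, (g x : ℝ≥0∞) ^ q ∂μ ≤ 1) {V : ℝ≥0} (hV : 0 < V) {ρ : X → ℝ≥0∞}
    (hρ : Measurable ρ) (hρp : ∫⁻ x, ρ x ^ p ∂μ = (V : ℝ≥0∞) ^ p)
    (hρg : (V : ℝ≥0∞) ≤ ∫⁻ x, ρ x * g x ∂μ) :
    ρ =ᵐ[μ] fun x => ((V * g x ^ (q - 1) : ℝ≥0) : ℝ≥0∞) := by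
  have hne : ∀ᵐ x ∂μ, ρ x ≠ ∞ := by
    have := ae_lt_top (hρ.pow_const p) (by
      rw [hρp]; exact ENNReal.rpow_ne_top_of_nonneg hpq.pos.le ENNReal.coe_ne_top)
    filter_upwards [this] with x hx h
    simp [h, hpq.pos] at hx
  have hcoe : ∀ᵐ x ∂μ, ((ρ x).toNNReal : ℝ≥0∞) = ρ x :=
    hne.mono fun x hx => ENNReal.coe_toNNReal hx
  -- The stability result for the constant sequence `ρ`: its a.e. limit is both `ρ` and the extremal
  -- function.
  obtain ⟨-, φ, -, hφ⟩ := exists_subseq_ae_tendsto_of_le_lintegral_mul hpq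
    (f := fun _ x => (ρ x).toNNReal) (fun _ => hρ.ennreal_toNNReal) hg hV
    (by
      refine tendsto_const_nhds.congr fun _ => ?_
      rw [← hρp]
      exact lintegral_congr_ae (hcoe.mono fun x hx => by simp only [hx])) hgq
    (fun _ => hρg.trans_eq (lintegral_congr_ae (hcoe.mono fun x hx => by simp only [hx])))
  filter_upwards [hcoe, hφ] with x h1 h2
  rw [← h1, tendsto_nhds_unique tendsto_const_nhds h2]

end Extremal

/-- Upper bound for the Lagrangian at admissible functions. `J = ∞` is allowed; the left side is
then `-∞`. -/
theorem eReal_sub_sub_le {N J : ℝ≥0∞} {B : ℝ} (h : ENNReal.ofReal B ≤ J) :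
    (N : EReal) - ((J : EReal) - (B : EReal)) ≤ N := by
  have h0 : (0 : EReal) ≤ (J : EReal) - (B : EReal) := by
    rw [EReal.sub_nonneg (Or.inr (EReal.coe_ne_top B)) (Or.inr (EReal.coe_ne_bot B))]
    refine le_trans ?_ (EReal.coe_ennreal_le_coe_ennreal_iff.2 h)
    rw [EReal.coe_ennreal_ofReal]
    exact EReal.coe_le_coe_iff.2 (le_max_left _ _)
  simpa using EReal.sub_le_sub (le_refl (N : EReal)) h0

/-- Lower bound for the Lagrangian at a dual-feasible measure; finiteness of `N` reduces it to real
arithmetic. -/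
theorem le_eReal_sub_sub {N J : ℝ≥0∞} {B : ℝ} (hN : N ≠ ∞) (h : J ≤ N) :
    (B : EReal) ≤ (N : EReal) - ((J : EReal) - (B : EReal)) := by
  lift J to ℝ≥0 using ne_top_of_le_ne_top hN h
  lift N to ℝ≥0 using hN
  have h' : (J : ℝ) ≤ N := by exact_mod_cast h
  rw [EReal.coe_nnreal_eq_coe_real, EReal.coe_nnreal_eq_coe_real, ← EReal.coe_sub,
    ← EReal.coe_sub, EReal.coe_le_coe_iff]
  linarith

end CurveModulus

/-! ### The main theorem -/

theorem proposition5p14 {X : Type*} [MetricSpace X] [CompactSpace X] [MeasurableSpace X]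
    [BorelSpace X] (μ : Measure X)
    (hμ : ∀ (x : X) (r : ℝ), 0 < r → 0 < μ (Metric.ball x r) ∧ μ (Metric.ball x r) < ∞)
    (p q : ℝ) (hp : 1 < p) (hq : q = p / (p - 1))
    (Γ : Set (Curv X)) (hΓ : IsCompact Γ) (b : C(Γ, ℝ)) (hb : 0 < ⨅ γ : Γ, b γ)
    (hpos : 0 < contModulus μ p Γ b) (hfin : contModulus μ p Γ b < ∞)
    (M : ℝ≥0∞) (hM : M = contModulus μ p Γ b ^ (1 / p) / ENNReal.ofReal (⨅ γ : Γ, b γ)) :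
    -- strong duality: the four quantities in the chain are equal
    ((contModulus μ p Γ b ^ (1 / p) =
        (⨅ (ρ : C(X, ℝ≥0)) (_ : IsAdmissible Γ b fun x => (ρ x : ℝ≥0∞)),
          eLpNorm (fun x => (ρ x : ℝ≥0∞)) (ENNReal.ofReal p) μ)) ∧
      (((contModulus μ p Γ b ^ (1 / p) : ℝ≥0∞) : EReal) =
        (⨅ ρ : C(X, ℝ≥0), ⨆ η ∈ {η ∈ radonMeasures Γ | η univ ≤ M}, lagrangian μ p b ρ η)) ∧
      ((⨅ ρ : C(X, ℝ≥0), ⨆ η ∈ {η ∈ radonMeasures Γ | η univ ≤ M}, lagrangian μ p b ρ η) =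
        (⨆ η ∈ {η ∈ radonMeasures Γ | η univ ≤ M}, ⨅ ρ : C(X, ℝ≥0), lagrangian μ p b ρ η)) ∧
      ((⨆ η ∈ {η ∈ radonMeasures Γ | η univ ≤ M}, ⨅ ρ : C(X, ℝ≥0), lagrangian μ p b ρ η) =
        (⨆ η ∈ {η ∈ barycenterClass μ q Γ | η univ ≤ M}, ((∫ γ, b γ ∂η : ℝ) : EReal)))) ∧
    ∃ (ρs : X → ℝ≥0∞) (ηs : Measure Γ),
      -- `ρs` is the weak minimizer, unique up to `μ`-null sets
      (IsWeakMinimizer μ p Γ b ρs ∧ ∫⁻ x, ρs x ^ p ∂μ < ∞ ∧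
        ∀ ρ, IsWeakMinimizer μ p Γ b ρ → ρ =ᵐ[μ] ρs) ∧
      -- `ηs` is a maximizer of the dual problem
      (ηs ∈ barycenterClass μ q Γ ∧ ηs univ ≤ M ∧
        ∀ η ∈ barycenterClass μ q Γ, η univ ≤ M → ∫ γ, b γ ∂η ≤ ∫ γ, b γ ∂ηs) ∧
      -- the optimal values
      (contModulus μ p Γ b ^ (1 / p) = eLpNorm ρs (ENNReal.ofReal p) μ ∧
        eLpNorm ρs (ENNReal.ofReal p) μ = ENNReal.ofReal (∫ γ, b γ ∂ηs)) ∧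
      -- complementary slackness, integrated and pointwise
      (Integrable (fun γ : Γ => (lineIntegral ρs γ).toReal - b γ) ηs ∧
        ∫ γ : Γ, ((lineIntegral ρs γ).toReal - b γ) ∂ηs = 0) ∧
      (∀ᵐ γ : Γ ∂ηs, lineIntegral ρs γ = ENNReal.ofReal (b γ)) ∧
      -- the density of the projected measure
      ((projectedMeasure ηs).rnDeriv μ =ᵐ[μ]
        fun x => (ρs x / eLpNorm ρs (ENNReal.ofReal p) μ) ^ (p - 1)) ∧
      (∀ ρ : X → ℝ≥0∞, Measurable ρ →
        ∫⁻ γ : Γ, lineIntegral ρ γ ∂ηs =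
          ∫⁻ x, ρ x * (ρs x / eLpNorm ρs (ENNReal.ofReal p) μ) ^ (p - 1) ∂μ) := by

  have hpq : p.HolderConjugate q := by
    rw [hq]; exact Real.HolderConjugate.conjExponent hp
  have hp0 : 0 < p := hpq.pos
  have hΓc : CompactSpace Γ := isCompact_iff_compactSpace.1 hΓ
  -- Together with compactness of `X` this makes `μ` finite.
  have hlf : IsLocallyFiniteMeasure μ :=
    ⟨fun x => ⟨Metric.ball x 1, Metric.ball_mem_nhds x one_pos, (hμ x 1 one_pos).2⟩⟩
  have hbβ : ∀ γ, (⨅ γ : Γ, b γ) ≤ b γ :=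
    fun γ => ciInf_le (isCompact_range b.continuous).bddBelow γ
  have hb0 : ∀ γ, 0 ≤ b γ := fun γ => hb.le.trans (hbβ γ)
  set K := contModulus μ p Γ b with hK
  obtain ⟨V, hKV⟩ : ∃ V : ℝ≥0, K ^ (1 / p) = V :=
    ⟨_, (ENNReal.coe_toNNReal
      (ENNReal.rpow_ne_top_of_nonneg (one_div_nonneg.2 hp0.le) hfin.ne)).symm⟩
  have hKp : K = (V : ℝ≥0∞) ^ p := by
    rw [← hKV, ← ENNReal.rpow_mul, one_div_mul_cancel hp0.ne', ENNReal.rpow_one]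
  have hV : 0 < V := by
    rw [← ENNReal.coe_pos, ← hKV]
    exact ENNReal.rpow_pos hpos hfin.ne
  have hV0 : (V : ℝ≥0∞) ≠ 0 := by simpa using hV.ne'
  have hMV : M = ENNReal.ofReal (V / ⨅ γ : Γ, b γ) := by
    rw [hM, hKV, ENNReal.ofReal_div_of_pos hb, ENNReal.ofReal_coe_nnreal]
  -- the dual optimizer
  obtain ⟨η, hη, hηM, hVη, g, hg, hηg, hgq⟩ := exists_dual_measure (μ := μ) hpq hΓ b hb hbβ
    V.coe_nonneg (by rw [ENNReal.ofReal_coe_nnreal]; exact hKV)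
  rw [← hMV] at hηM
  have hηfin := hη.1
  have hgm : Measurable fun x => (g x : ℝ≥0∞) := hg.coe_nnreal_ennreal
  have hηB : η ∈ barycenterClass μ q Γ := ⟨hη, _, hgm, hηg, by
    rw [eLpNorm_ofReal_eq μ hpq.symm.pos]
    exact ENNReal.rpow_le_one hgq (one_div_nonneg.2 hpq.symm.pos.le)⟩
  have hdens : ∀ ρ : X → ℝ≥0∞, Measurable ρ →
      ∫⁻ γ : Γ, lineIntegral ρ γ ∂η = ∫⁻ x, ρ x * g x ∂μ :=
    fun ρ hρ => lintegral_lineIntegral_of_density hgm hηg hρ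
  -- a minimizing sequence
  obtain ⟨f, hf, hfK⟩ := exists_minimizing_seq (μ := μ) (p := p) b hfin.ne
  have hfV : Tendsto (fun n => (∫⁻ x, (f n x : ℝ≥0∞) ^ p ∂μ) ^ (1 / p)) atTop (𝓝 V) := by
    have := (ENNReal.continuous_rpow_const (y := 1 / p)).tendsto _ |>.comp hfK
    rwa [← hK, hKV] at this
  have hle : ∀ η' ∈ barycenterClass μ q Γ, ∫ γ, b γ ∂η' ≤ V := fun η' hη' => by
    have h1 := ge_of_tendsto' hfV fun n => ofReal_integral_le_rpow_lintegral hpq hb0 hη' (hf n)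
    rw [← ENNReal.ofReal_coe_nnreal] at h1
    exact (ENNReal.ofReal_le_ofReal_iff V.coe_nonneg).1 h1
  have hbV : ∫ γ, b γ ∂η = V := le_antisymm (hle η hηB) hVη
  have hbV' : ENNReal.ofReal (∫ γ, b γ ∂η) = V := by rw [hbV, ENNReal.ofReal_coe_nnreal]
  -- `V = ∫ b dη ≤ ∫∫_γ ρ ds dη = ∫ ρ g dμ`. This single inequality drives both the convergence of
  -- the minimizing sequence and the uniqueness of weak minimizers.
  have hweak : ∀ ρ : X → ℝ≥0∞, IsWeaklyAdmissible μ p Γ b ρ →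
      (V : ℝ≥0∞) ≤ ∫⁻ x, ρ x * g x ∂μ := fun ρ hρ => by
    rw [← hdens ρ hρ.1, ← hbV']
    exact ofReal_integral_le_lintegral hb0
      (ae_le_lineIntegral_of_isWeaklyAdmissible hpq hηB hρ)
  have hfm : ∀ n, Measurable (f n) := fun n => (f n).continuous.measurable
  obtain ⟨hgq1, φ, hφ, hae⟩ := exists_subseq_ae_tendsto_of_le_lintegral_mul (μ := μ) hpq
    (f := fun n x => f n x) hfm hg hV (by rw [← hKp]; exact hfK) hgq
    -- Admissible functions are weakly admissible with empty exceptional family, whose modulus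
    -- vanishes because `ρ = 0` is admissible for it.
    (fun n => hweak _ ⟨(hf n).1, ∅, le_antisymm ((iInf₂_le (fun _ => 0)
      ⟨measurable_const, fun γ => γ.2.elim⟩).trans (by simp [hp0])) zero_le,
      fun γ _ => (hf n).2 γ⟩)
  -- the weak minimizer
  let G : X → ℝ≥0 := fun x => V * g x ^ (q - 1)
  have hGm : Measurable G := (hg.pow_const _).const_mul _
  let ρs : X → ℝ≥0∞ := fun x => (G x : ℝ≥0∞)
  have hρm : Measurable ρs := hGm.coe_nnreal_ennreal
  have hq1 : 0 ≤ q - 1 := sub_nonneg.2 hpq.symm.lt.le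
  have hp1 : 0 ≤ p - 1 := sub_nonneg.2 hpq.lt.le
  have hρs : ∀ x, ρs x = V * (g x : ℝ≥0∞) ^ (q - 1) := fun x => by
    simp only [ρs, G]
    rw [ENNReal.coe_mul, ENNReal.coe_rpow_of_nonneg _ hq1]
  have hρp : ∫⁻ x, ρs x ^ p ∂μ = (V : ℝ≥0∞) ^ p := by
    simp_rw [hρs, ENNReal.mul_rpow_of_nonneg _ _ hp0.le, ← ENNReal.rpow_mul,
      hpq.symm.sub_one_mul_conj]
    rw [lintegral_const_mul _ (hgm.pow_const _), hgq1, mul_one]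
  have hρN : eLpNorm ρs (ENNReal.ofReal p) μ = V := by
    rw [eLpNorm_ofReal_eq μ hp0, hρp, ← hKp, hKV]
  have hρadm : IsWeaklyAdmissible μ p Γ b ρs := by
    refine isWeaklyAdmissible_of_tendsto hp0 (f := fun k x => (f (φ k) x : ℝ≥0∞))
      (fun k => hf (φ k)) hρm ?_
    refine tendsto_lintegral_sub_rpow hpq.lt.le (f := fun k x => f (φ k) x) (G := G)
      (fun k => hfm (φ k)) hGm ?_ ?_ hae
    · rw [hρp, ← hKp]
      exact hfK.comp hφ.tendsto_atTop
    · rw [hρp, ← hKp]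
      exact hfin.ne
  have hdiv : ∀ x, (ρs x / V) ^ (p - 1) = g x := fun x => by
    rw [hρs, mul_comm, ENNReal.mul_div_cancel_right hV0 ENNReal.coe_ne_top, ← ENNReal.rpow_mul,
      show (q - 1) * (p - 1) = 1 by linear_combination hpq.symm.sub_one_mul_conj,
      ENNReal.rpow_one]
  have hρg : ∫⁻ γ : Γ, lineIntegral ρs γ ∂η = V := by
    rw [hdens ρs hρm]
    have : ∀ x, ρs x * g x = V * (g x : ℝ≥0∞) ^ q := fun x => by
      rw [hρs, mul_assoc]
      congr 1
      conv_lhs => rw [← ENNReal.rpow_one (g x : ℝ≥0∞), ← ENNReal.rpow_mul, one_mul,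
        ← ENNReal.rpow_add_of_nonneg _ _ hq1 zero_le_one, sub_add_cancel]
    simp_rw [this]
    rw [lintegral_const_mul _ (hgm.pow_const _), hgq1, mul_one]
  -- The inequality `b ≤ ∫_γ ρs ds` holds `η`-a.e., and both sides have the same finite integral
  -- `V`.
  have hslack : ∀ᵐ γ : Γ ∂η, lineIntegral ρs γ = ENNReal.ofReal (b γ) := by
    have hint := b.continuous.integrable_of_hasCompactSupport (μ := η)
      (HasCompactSupport.of_compactSpace _)
    have hbl : ∫⁻ γ, ENNReal.ofReal (b γ) ∂η = V := by
      rw [← ofReal_integral_eq_lintegral_ofReal hint (Eventually.of_forall hb0), hbV']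
    refine (ae_eq_of_ae_le_of_lintegral_le
      (ae_le_lineIntegral_of_isWeaklyAdmissible hpq hηB hρadm) ?_
      ((measurable_lineIntegral hρm).comp measurable_subtype_coe).aemeasurable ?_).symm
    · rw [hbl]; exact ENNReal.coe_ne_top
    · rw [hbl, hρg]
  have hslack0 : (fun γ : Γ => (lineIntegral ρs γ).toReal - b γ) =ᵐ[η] fun _ => 0 :=
    hslack.mono fun γ hγ => by
      simp only
      rw [hγ, ENNReal.toReal_ofReal (hb0 γ), sub_self]
  -- the Lagrangian
  have hNeq : ∀ ρ : C(X, ℝ≥0), eLpNorm (fun x => (ρ x : ℝ≥0∞)) (ENNReal.ofReal p) μ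
      = (∫⁻ x, (ρ x : ℝ≥0∞) ^ p ∂μ) ^ (1 / p) := fun ρ => eLpNorm_ofReal_eq μ hp0 _
  have hNt : ∀ ρ : C(X, ℝ≥0), eLpNorm (fun x => (ρ x : ℝ≥0∞)) (ENNReal.ofReal p) μ ≠ ∞ :=
    fun ρ => eLpNorm_coe_ne_top μ hp0 ρ
  have hLlow : ∀ ρ : C(X, ℝ≥0), ((V : ℝ≥0∞) : EReal) ≤ lagrangian μ p b ρ η := fun ρ => by
    rw [EReal.coe_nnreal_eq_coe_real, ← hbV]
    refine le_eReal_sub_sub (hNt ρ) ?_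
    rw [hNeq]
    exact lintegral_lineIntegral_le hpq hηB ρ.continuous.measurable.coe_nnreal_ennreal
  have hLup : ∀ (ρ : C(X, ℝ≥0)), IsAdmissible Γ b (fun x => (ρ x : ℝ≥0∞)) →
      ∀ η' ∈ radonMeasures Γ, lagrangian μ p b ρ η' ≤
        eLpNorm (fun x => (ρ x : ℝ≥0∞)) (ENNReal.ofReal p) μ := fun ρ hρ η' hη' => by
    have := hη'.1
    exact eReal_sub_sub_le (ofReal_integral_le_lintegral hb0 (Eventually.of_forall hρ.2))
  have hinfsup : (⨅ ρ : C(X, ℝ≥0), ⨆ η ∈ {η ∈ radonMeasures Γ | η univ ≤ M},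
      lagrangian μ p b ρ η) = ((V : ℝ≥0∞) : EReal) := by
    refine le_antisymm ?_ (le_iInf fun ρ => (hLlow ρ).trans
      (le_iSup₂ (f := fun η _ => lagrangian μ p b ρ η) η ⟨hη, hηM⟩))
    refine ge_of_tendsto' ((continuous_coe_ennreal_ereal.tendsto _).comp hfV) fun n => ?_
    refine (iInf_le _ (f n)).trans (iSup₂_le fun η' hη' => ?_)
    simp only [Function.comp, ← hNeq]
    exact hLup (f n) (hf n) η' hη'.1
  -- The upper bound is the general `sup inf ≤ inf sup`; the lower bound is realized by `η`, at
  -- which the Lagrangian is at least `V` for every `ρ`.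
  have hsupinf : (⨆ η ∈ {η ∈ radonMeasures Γ | η univ ≤ M}, ⨅ ρ : C(X, ℝ≥0),
      lagrangian μ p b ρ η) = ((V : ℝ≥0∞) : EReal) := by
    refine le_antisymm ?_ (le_trans (le_iInf hLlow)
      (le_iSup₂ (f := fun η _ => ⨅ ρ : C(X, ℝ≥0), lagrangian μ p b ρ η) η ⟨hη, hηM⟩))
    rw [← hinfsup]
    exact iSup₂_le fun η' hη' => le_iInf fun ρ => (iInf_le _ ρ).trans
      (le_iSup₂ (f := fun η _ => lagrangian μ p b ρ η) η' hη')
  have hsup : (⨆ η ∈ {η ∈ barycenterClass μ q Γ | η univ ≤ M}, ((∫ γ, b γ ∂η : ℝ) : EReal))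
      = ((V : ℝ≥0∞) : EReal) := by
    rw [EReal.coe_nnreal_eq_coe_real]
    refine le_antisymm (iSup₂_le fun η' hη' => EReal.coe_le_coe_iff.2 (hle η' hη'.1)) ?_
    rw [← hbV]
    exact le_iSup₂ (f := fun (η : Measure Γ) _ => ((∫ γ, b γ ∂η : ℝ) : EReal)) η ⟨hηB, hηM⟩
  refine ⟨⟨?_, ?_, ?_, ?_⟩, ρs, η, ⟨⟨hρadm, hρp.trans hKp.symm⟩, ?_, ?_⟩, ⟨hηB, hηM, ?_⟩,
    ⟨?_, ?_⟩, ⟨?_, ?_⟩, hslack, ?_, ?_⟩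
  · refine le_antisymm (le_iInf₂ fun ρ hρ => ?_) ?_
    · rw [hNeq]
      exact rpow_contModulus_le hp0 ρ hρ
    · rw [hKV]
      refine ge_of_tendsto' hfV fun n => ?_
      rw [← hNeq]
      exact iInf₂_le (f n) (hf n)
  · rw [hinfsup, hKV]
  · rw [hinfsup, hsupinf]
  · rw [hsupinf, hsup]
  · rw [hρp, ← hKp]; exact hfin
  · intro ρ hρ
    exact ae_eq_of_le_lintegral_mul hpq hg hgq hV hρ.1.1 (hρ.2.trans hKp) (hweak ρ hρ.1)
  · intro η' hη' _
    rw [hbV]; exact hle η' hη'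
  · rw [hKV, hρN]
  · rw [hρN, hbV']
  · exact (integrable_zero _ _ _).congr hslack0.symm
  · rw [integral_congr_ae hslack0, integral_zero]
  · rw [hηg, hρN]
    filter_upwards [Measure.rnDeriv_withDensity μ hgm] with x hx
    rw [hx, hdiv]
  · intro ρ hρ
    rw [hdens ρ hρ, hρN]
    simp_rw [hdiv]
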